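/- Consider the $O(N)^3$ tensor model of a real rank-3 tensor $\phi^{abc}$ with the single (prism) interaction $$\phi_1^{a_1b_1c_1}\phi_2^{a_1b_2c_2}\phi_3^{a_2b_2c_1}\phi_4^{a_2b_3c_3}\phi_5^{a_3b_3c_2}\phi_6^{a_3b_1c_3},$$ whose interaction graph is a triangular prism with the triangles $\{1,2,3\}$ and $\{6,5,4\}$, the rungs $16$, $25$, $34$, and edges of three colours, one for each kind of index ($a$: $12,34,56$; $b$: $23,45,61$; $c$: $13,25,46$). A vacuum diagram consists of finitely many prism vertices with a Wick contraction of all their fields in pairs (the pairs are the propagators), together with a number of closed propagators without vertices; diagrams are identified if they differ only by a bijection of the fields that respects the propagators and the coloured edges of the interaction vertices. For each colour, the index lines of that colour, which run alternately along propagators and edges of that colour of the vertices, form closed loops (a closed propagator without vertices counts as one loop of each colour); $f_{tot}$ is the total number of loops of the three colours. A connected vacuum diagram is maximal if no connected vacuum diagram with the same number of prism vertices has a larger $f_{tot}$. The empty diagram ($0$-cycle) is the connected diagram without vertices, i.e. one closed propagator. Consider the following three moves. 1. Elementary snail: replace a propagator by the two-point diagram obtained by cutting open one propagator of the diagram with one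 prism vertex and contractions $\langle 1,6\rangle,\langle 2,5\rangle,\langle 3,4\rangle$. 2. Elementary melon: replace a propagator by the two-point diagram obtained by cutting open one propagator of the diagram with two prism vertices $L,R$ and contractions $\langle i_L,i_R\rangle$, $i=1,\dots,6$. 3. Vertex expansion: replace a prism vertex by two prism vertices $L,R$ with contractions $\langle 1_L,1_R\rangle,\langle 2_L,2_R\rangle,\langle 3_L,3_R\rangle$, the remaining fields $6_L,5_L,4_L$ and $6_R,5_R,4_R$ taking over the external contractions of the fields $6,5,4$ and $1,2,3$, respectively, of the old vertex. Then a vacuum diagram is maximal if and only if it can be obtained from the empty diagram by finitely many of these moves. That is, every maximal vacuum diagram is generated from the empty diagram by elementary melons, elementary snails and vertex expansions, and all diagrams so produced are maximal. -/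

import Mathlib

/-- The three colours (one for each `O(N)` symmetry group). -/
abbrev PrismColour := Fin 3

/-- The six fields of a prism interaction.  The prism interaction graph is the skeleton of a
triangular prism: two triangles, joined by three rungs.  The field `(s, c)` is the corner of the
triangle `s` whose rung has colour `c`.  In the labelling in which the interaction is
`φ₁^{a₁b₁c₁} φ₂^{a₁b₂c₂} φ₃^{a₂b₂c₁} φ₄^{a₂b₃c₃} φ₅^{a₃b₃c₂} φ₆^{a₃b₁c₃}`, fields `1, 2, 3` are
`(false, 0), (false, 1), (false, 2)`, fields `6, 5, 4` are `(true, 0), (true, 1), (true, 2)`, and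
the colours of the indices `b, c, a` are `0, 1, 2`. -/
abbrev PrismField := Bool × PrismColour

/-- `prismPartner c x` is the field joined to `x` by the edge of colour `c` of the prism
interaction graph: the rung at `(s, c)` has colour `c`, and a triangle edge
joining the corners `(s, c₁)` and `(s, c₂)` has the third colour, `-(c₁ + c₂)` modulo `3`. -/
def prismPartner (c : PrismColour) (x : PrismField) : PrismField :=
  if x.2 = c then (!x.1, x.2) else (x.1, -(x.2 + c))

/-- A vacuum Feynman diagram (possibly disconnected) of the rank-3 prism theory: a finite set `V` of
prism vertices, a Wick contraction of all their fields in pairs, and a number `rings` of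
closed propagators without any vertex. -/
structure PrismDiagram where
  /-- the interaction vertices -/
  V : Type
  finite : Finite V
  /-- the field with which a given field is Wick-contracted -/
  contr : V × PrismField → V × PrismField
  contr_contr : ∀ x, contr (contr x) = x
  contr_ne : ∀ x, contr x ≠ x
  /-- the number of closed propagators without interaction vertices -/
  rings : ℕ

namespace PrismDiagram

attribute [instance] PrismDiagram.finite

/-- The fields of all the vertices of `D`, that is, the ends of its propagators. -/
abbrev HalfEdge (D : PrismDiagram) : Type := D.V × PrismField

/-- The number of interaction vertices. -/
noncomputable def numVertices (D : PrismDiagram) : ℕ := Nat.card D.V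

/-- Two fields are consecutive on an index line of colour `c`: they are joined
by a propagator, or by the edge of colour `c` of a prism vertex. -/
def Strand (D : PrismDiagram) (c : PrismColour) (x y : D.HalfEdge) : Prop :=
  y = D.contr x ∨ y = (x.1, prismPartner c x.2)

/-- The number of closed index loops of colour `c`. -/
noncomputable def loops (D : PrismDiagram) (c : PrismColour) : ℕ :=
  Nat.card (Quot (D.Strand c)) + D.rings

/-- The total number `f_total` of index loops, the power of `N` carried by the diagram. -/
noncomputable def totalLoops (D : PrismDiagram) : ℕ := ∑ c : PrismColour, D.loops c

/-- Two vertices are joined by a propagator. -/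
def Adj (D : PrismDiagram) (v w : D.V) : Prop :=
  ∃ i j : PrismField, D.contr (v, i) = (w, j)

/-- A diagram is connected if it has exactly one connected component. -/
def Connected (D : PrismDiagram) : Prop := Nat.card (Quot D.Adj) + D.rings = 1

/-- A maximal diagram: a connected vacuum diagram with the largest number of index loops among
all connected vacuum diagrams with the same number of interaction vertices. -/
def IsMaximal (D : PrismDiagram) : Prop :=
  D.Connected ∧ ∀ D' : PrismDiagram, D'.Connected → D'.numVertices = D.numVertices →
    D'.totalLoops ≤ D.totalLoops

/-- `D` and `D'` are the same multi-line diagram: a bijection between their fields respects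
propagators and the coloured edges of the interaction vertices (hence induces a bijection of
vertices, with an automorphism of the prism at each of them). -/
def Iso (D D' : PrismDiagram) : Prop :=
  D.rings = D'.rings ∧ ∃ e : D.HalfEdge ≃ D'.HalfEdge,
    (∀ x, e (D.contr x) = D'.contr (e x)) ∧
    ∀ (c : PrismColour) (x : D.HalfEdge),
      e (x.1, prismPartner c x.2) = ((e x).1, prismPartner c (e x).2)

/-- The diagram without interaction vertices: one closed propagator. -/
def zeroCycle : PrismDiagram where
  V := Empty
  finite := inferInstance
  contr := id
  contr_contr := fun _ => rfl
  contr_ne := fun x => x.1.elim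
  rings := 1

/-- The vacuum diagram with one prism vertex in which the two ends of each rung are contracted.
Cut open at any propagator it is an elementary snail. -/
def closedSnail : PrismDiagram where
  V := Unit
  finite := inferInstance
  contr := fun x => (x.1, (!x.2.1, x.2.2))
  contr_contr := by simp
  contr_ne := by
    rintro ⟨_, s, c⟩ h
    simp at h
  rings := 0

/-- The vacuum diagram with two prism vertices in which each field of one vertex is
contracted with the same field of the other.  Cut open at any propagator it is an elementary
melon. -/
def closedMelon : PrismDiagram where
  V := Bool
  finite := inferInstance
  contr := fun x => (!x.1, x.2)
  contr_contr := by simp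
  contr_ne := by
    rintro ⟨s, x⟩ h
    simp at h
  rings := 0

/-- Juxtaposition of two diagrams. -/
def union (D E : PrismDiagram) : PrismDiagram where
  V := D.V ⊕ E.V
  finite := inferInstance
  contr := fun x => match x with
    | (Sum.inl v, i) => (Sum.inl (D.contr (v, i)).1, (D.contr (v, i)).2)
    | (Sum.inr w, i) => (Sum.inr (E.contr (w, i)).1, (E.contr (w, i)).2)
  contr_contr := by
    rintro ⟨v | w, i⟩
    · simp [D.contr_contr]
    · simp [E.contr_contr]
  contr_ne := by
    rintro ⟨v | w, i⟩ h
    · simp only [Prod.mk.injEq, Sum.inl.injEq] at h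
      exact D.contr_ne (v, i) (Prod.ext h.1 h.2)
    · simp only [Prod.mk.injEq, Sum.inr.injEq] at h
      exact E.contr_ne (w, i) (Prod.ext h.1 h.2)
  rings := D.rings + E.rings

/-- Move the ends of the propagators along the permutation `π` of the fields: the propagator
that joined `x` and `y` now joins `π x` and `π y`. -/
def rewire (D : PrismDiagram) (π : Equiv.Perm D.HalfEdge) : PrismDiagram where
  V := D.V
  finite := D.finite
  contr := fun x => π (D.contr (π.symm x))
  contr_contr := by simp [D.contr_contr]
  contr_ne := by
    intro x h
    apply D.contr_ne (π.symm x)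
    exact (Equiv.eq_symm_apply π).2 h
  rings := D.rings

/-- The fields of `D`, as fields of `D.union E`. -/
def left {D : PrismDiagram} (E : PrismDiagram) (x : D.HalfEdge) : (D.union E).HalfEdge :=
  (Sum.inl x.1, x.2)

/-- The fields of `E`, as fields of `D.union E`. -/
def right (D : PrismDiagram) {E : PrismDiagram} (a : E.HalfEdge) : (D.union E).HalfEdge :=
  (Sum.inr a.1, a.2)

open Classical in
/-- Replace the propagator of `D` that joins `h` and `D.contr h` by the two-point diagram
obtained by cutting `E` open at the propagator that joins `a` and `E.contr a`: these two
propagators are replaced by a propagator that joins `h` and `a`, and one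
that joins `D.contr h` and `E.contr a`. -/
noncomputable def replaceEdge (D E : PrismDiagram) (h : D.HalfEdge) (a : E.HalfEdge) :
    PrismDiagram :=
  (D.union E).rewire (Equiv.swap (left E (D.contr h)) (right D a))

/-- Replace a closed propagator of `D` by the two-point diagram obtained by cutting `E` open at a
propagator: joining the two ends of the latter gives `E` back, so this
removes a closed propagator of `D` and adds `E`.  (Used only if `0 < D.rings`.) -/
def replaceRing (D E : PrismDiagram) : PrismDiagram :=
  { D.union E with rings := D.rings - 1 + E.rings }

open Classical in
/-- On the fields of `D` and of one more vertex: exchange the field `(false, c)` of the vertex `v`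
of `D` with the field `(true, c)` of the additional vertex, for each colour `c`. -/
noncomputable def exchange (D : PrismDiagram) (v : D.V) :
    (D.V ⊕ Unit) × PrismField → (D.V ⊕ Unit) × PrismField
  | (Sum.inl w, (false, c)) =>
      if w = v then (Sum.inr (), (true, c)) else (Sum.inl w, (false, c))
  | (Sum.inl w, (true, c)) => (Sum.inl w, (true, c))
  | (Sum.inr _, (false, c)) => (Sum.inr (), (false, c))
  | (Sum.inr _, (true, c)) => (Sum.inl v, (false, c))

theorem exchange_involutive (D : PrismDiagram) (v : D.V) :
    Function.Involutive (D.exchange v) := by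
  rintro ⟨w | _, s | s, c⟩
  · by_cases h : w = v <;> simp [exchange, h]
  · simp [exchange]
  · simp [exchange]
  · simp [exchange]

/-- Vertex expansion at the vertex `v` of `D`.  There is one new prism vertex `R`; the vertex `v`
keeps the external connections of its triangle `true`, the triangle `true` of `R` takes over those
of the triangle `false` of `v`, corner by corner, and the triangles `false` of `v` and `R` are
contracted with each other corner by corner.  (We start from `D` and a vertex `R` whose triangles
are contracted with each other, and exchange the propagator ends at `(v, (false, c))`
and `(R, (true, c))` for each colour `c`.) -/
noncomputable def expand (D : PrismDiagram) (v : D.V) : PrismDiagram :=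
  (D.union closedSnail).rewire (D.exchange_involutive v).toPerm

/-- The diagrams generated from the diagram without vertices by replacing propagators by
elementary snails, replacing propagators by elementary melons, and vertex expansion.  Diagrams are
considered up to the names of vertices and fields. -/
inductive Generated : PrismDiagram → Prop
  | zeroCycle : Generated zeroCycle
  | iso {D D' : PrismDiagram} : Generated D → Iso D D' → Generated D'
  | snail {D : PrismDiagram} (h : D.HalfEdge) (a : closedSnail.HalfEdge) :
      Generated D → Generated (D.replaceEdge closedSnail h a)
  | snailRing {D : PrismDiagram} :
      0 < D.rings → Generated D → Generated (D.replaceRing closedSnail)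
  | melon {D : PrismDiagram} (h : D.HalfEdge) (a : closedMelon.HalfEdge) :
      Generated D → Generated (D.replaceEdge closedMelon h a)
  | melonRing {D : PrismDiagram} :
      0 < D.rings → Generated D → Generated (D.replaceRing closedMelon)
  | expand {D : PrismDiagram} (v : D.V) : Generated D → Generated (D.expand v)

end PrismDiagram

/-!
Split every prism into its two triangles, joined by a propagator of an auxiliary field.  This gives
a diagram of the tetrahedral model, whose index loops of a colour are counted by the dimension over
`ZMod 2` of the space of functions on the fields that are constant along the lines of this colour.
Euler's inequality for the ribbon graphs of the three pairs of colours shows that a connected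
diagram with `n` prism vertices has at most `3 + 3 n` loops.

If there are that many, all three ribbon graphs are planar.  Planarity forces the loops to have even
length, and then counting their lengths yields a loop of length two.  Together with the propagators
at its two vertices it forms a melon of the tetrahedral diagram, or else it separates the diagram
into two parts, each joined to the rest by two propagators; passing to smaller and smaller parts one
finds a melon.  In terms of prisms, a melon is a vertex with two rungs contracted, that is, an
elementary snail, or a pair of vertices with two triangles contracted, that is, an expanded vertex.
Undoing the move, one concludes by induction on the number of vertices.

Conversely each move takes the union of the diagram with one that attains the bound and permutes
some contractions.  For every set of colours this joins one component of the lines to one component,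
so the number of loops stays the largest possible.
-/

open Module

theorem exists_third_colour (b c : Fin 3) : ∃ d : Fin 3, b ≠ d ∧ c ≠ d := by
  revert b c; decide

theorem zmod_two_eq_zero_or_one (a : ZMod 2) : a = 0 ∨ a = 1 := by
  revert a; decide

theorem finrank_le_ncard_of_vanish {K ι : Type*} [Field K] [Finite ι] (P : Submodule K (ι → K))
    (J : Set ι) (h : ∀ f ∈ P, (∀ j ∈ J, f j = 0) → f = 0) : finrank K P ≤ J.ncard := by
  have restrict_injective :
      Function.Injective ((LinearMap.funLeft K K ((↑) : J → ι)).comp P.subtype) := by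
    rw [← LinearMap.ker_eq_bot, LinearMap.ker_eq_bot']
    exact fun f hf => Subtype.ext (h f f.2 fun j hj => congrFun hf ⟨j, hj⟩)
  have : Fintype J := Fintype.ofFinite J
  calc finrank K P ≤ finrank K (J → K) :=
        LinearMap.finrank_le_finrank_of_injective restrict_injective
    _ = J.ncard := by
        rw [finrank_fintype_fun_eq_card, ← Nat.card_eq_fintype_card, Nat.card_coe_set_eq]

theorem sum_eq_zero_of_involution {R ι : Type*} [Ring R] [CharP R 2] {σ : ι → ι}
    (hσ : Function.Involutive σ) (hne : ∀ x, σ x ≠ x) {s : Finset ι} (hs : ∀ x ∈ s, σ x ∈ s)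
    {f : ι → R} (hf : ∀ x ∈ s, f (σ x) = f x) : ∑ x ∈ s, f x = 0 := by
  classical
  exact Finset.sum_involution (fun x _ => σ x)
    (fun x hx => by rw [hf x hx, CharTwo.add_self_eq_zero])
    (fun x _ _ => hne x) hs (fun x _ => hσ x)

/-- The functions with values in `K` that are constant along the relation `r` and vanish
outside `A`.  Over `ZMod 2` they are the unions of those classes generated by `r` that
lie inside `A`. -/
def relationFun (K : Type*) [Semiring K] {X : Type*} (r : X → X → Prop) (A : Set X) :
    Submodule K (X → K) where
  carrier := {f | (∀ x y, r x y → f x = f y) ∧ ∀ x ∉ A, f x = 0}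
  add_mem' := by
    rintro f g ⟨hf, hf'⟩ ⟨hg, hg'⟩
    exact ⟨fun x y h => congrArg₂ (· + ·) (hf x y h) (hg x y h),
      fun x hx => by simp [hf' x hx, hg' x hx]⟩
  zero_mem' := ⟨fun _ _ _ => rfl, fun _ _ => rfl⟩
  smul_mem' := by
    rintro a f ⟨hf, hf'⟩
    exact ⟨fun x y h => congrArg (a • ·) (hf x y h), fun x hx => by simp [hf' x hx]⟩

theorem finrank_relationFun (K : Type*) [Field K] {X : Type*} [Finite X] (r : X → X → Prop)
    (A : Set X) : finrank K (relationFun K r A) =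
      Nat.card {q : Quot r // ∀ x, Quot.mk r x = q → x ∈ A} := by
  let P (q : Quot r) : Prop := ∀ x, Quot.mk r x = q → x ∈ A
  let lift : ({q // P q} → K) →ₗ[K] X → K :=
    (LinearMap.funLeft K K (Quot.mk r)).comp (Function.ExtendByZero.linearMap K Subtype.val)
  have lift_injective : Function.Injective lift :=
    (LinearMap.funLeft_injective_of_surjective K K _ Quot.mk_surjective).comp
      (Function.extend_injective Subtype.val_injective (0 : Quot r → K))
  have range_lift : LinearMap.range lift = relationFun K r A := by
    ext f
    constructor
    · rintro ⟨g, rfl⟩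
      exact ⟨fun x y h => congrArg (Function.extend Subtype.val g 0) (Quot.sound h),
        fun x hx => Function.extend_val_apply' fun h => hx (h x rfl)⟩
    · rintro ⟨hr, hA⟩
      refine ⟨fun q => Quot.lift f hr q.1, funext fun x => ?_⟩
      change Function.extend (Subtype.val (p := P)) (fun q => Quot.lift f hr q) (0 : Quot r → K) _ =
        f x
      by_cases h : P (Quot.mk r x)
      · rw [Function.extend_val_apply h]
      · obtain ⟨y, hyx, hy⟩ := not_forall₂.1 h
        rw [Function.extend_val_apply' h]
        exact (hA y hy).symm.trans (congrArg (Quot.lift f hr) hyx)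
  have := Fintype.ofFinite {q // P q}
  rw [← range_lift, LinearMap.finrank_range_of_inj lift_injective, finrank_fintype_fun_eq_card,
    Nat.card_eq_fintype_card]

theorem finrank_relationFun_univ (K : Type*) [Field K] {X : Type*} [Finite X]
    (r : X → X → Prop) : finrank K (relationFun K r Set.univ) = Nat.card (Quot r) := by
  rw [finrank_relationFun]
  exact Nat.card_congr (Equiv.subtypeUnivEquiv fun q x _ => Set.mem_univ x)

theorem mul_finrank_relationFun_le {K : Type*} [Field K] {X : Type*} [Finite X]
    {r : X → X → Prop} {A B : Set X} {m : ℕ}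
    (hB : ∀ f ∈ relationFun K r A, f.support ⊆ B)
    (hm : ∀ f ∈ relationFun K r A, f ≠ 0 → m ≤ f.support.ncard) :
    m * finrank K (relationFun K r A) ≤ B.ncard := by
  rw [finrank_relationFun]
  let Q := {q : Quot r // ∀ x, Quot.mk r x = q → x ∈ A}
  let cls (q : Q) : Set X := {x | Quot.mk r x = q}
  have indicator_mem q : (cls q).indicator 1 ∈ relationFun K r A :=
    ⟨fun x y h => Set.indicator_eq_indicator (by
        simp only [cls, Set.mem_ofPred_eq, Quot.sound h]) rfl,
      fun x hx => Set.indicator_of_notMem (fun h => hx (q.2 x h)) 1⟩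
  have support_indicator q : ((cls q).indicator (1 : X → K)).support = cls q := by
    simp [Set.support_indicator]
  have le_ncard_cls q : m ≤ (cls q).ncard := by
    obtain ⟨x, hx⟩ := Quot.mk_surjective q.1
    rw [← support_indicator]
    refine hm _ (indicator_mem q) fun h => ?_
    simpa [cls, hx] using congrFun h x
  have := Fintype.ofFinite Q
  calc m * Nat.card Q ≤ ∑ q : Q, (cls q).ncard := by
        rw [Nat.card_eq_fintype_card, mul_comm, ← smul_eq_mul]
        exact Finset.card_nsmul_le_sum _ _ _ fun q _ => le_ncard_cls q
    _ = Nat.card (Σ q : Q, cls q) := by simp [Nat.card_sigma]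
    _ ≤ Nat.card B := Nat.card_le_card_of_injective
        (fun p => ⟨p.2, hB _ (indicator_mem p.1) ((support_indicator p.1).ge p.2.2)⟩) ?_
  rintro ⟨q, x, hx⟩ ⟨q', x', hx'⟩ h
  obtain rfl : x = x' := congrArg Subtype.val h
  obtain rfl : q = q' := Subtype.ext (hx.symm.trans hx')
  rfl

theorem finrank_le_finrank_inf_ker_add_one {K V : Type*} [Field K] [AddCommGroup V] [Module K V]
    [FiniteDimensional K V] (P : Submodule K V) (φ : Dual K V) :
    finrank K P ≤ finrank K (P ⊓ LinearMap.ker φ : Submodule K V) + 1 := by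
  have rank_nullity := LinearMap.finrank_range_add_finrank_ker φ
  have finrank_range_le := Submodule.finrank_le (LinearMap.range φ)
  have sup_inf := Submodule.finrank_sup_add_finrank_inf_eq P (LinearMap.ker φ)
  have finrank_sup_le := Submodule.finrank_le (P ⊔ LinearMap.ker φ)
  rw [finrank_self] at finrank_range_le
  omega

/-- The third field of a vertex of the tetrahedral model: the corner `c` of a triangle is `some c`,
and the auxiliary field joined to the corner `c` by an edge of colour `c` is `none`. -/
abbrev TetraField := Option (Fin 3)

/-- `tetraPartner c k` is the field joined to `k` by the edge of colour `c` of the tetrahedron. -/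
def tetraPartner (c : Fin 3) : TetraField → TetraField
  | none => some c
  | some d => if d = c then none else some (-(d + c))

theorem tetraPartner_involutive (c : Fin 3) : Function.Involutive (tetraPartner c) := by
  revert c; unfold Function.Involutive; decide

theorem tetraPartner_ne (c : Fin 3) (k : TetraField) : tetraPartner c k ≠ k := by
  revert c k; decide

theorem tetraPartner_inj {b c : Fin 3} {k : TetraField} :
    tetraPartner b k = tetraPartner c k ↔ b = c := by
  revert b c k; decide

theorem tetraPartner_comp {b c d : Fin 3} (hbc : b ≠ c) (hbd : b ≠ d) (hcd : c ≠ d)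
    (k : TetraField) : tetraPartner b (tetraPartner c k) = tetraPartner d k := by
  revert b c d k; decide

theorem tetraField_cases {b c d : Fin 3} (hbc : b ≠ c) (hbd : b ≠ d) (hcd : c ≠ d)
    (k l : TetraField) :
    l = k ∨ l = tetraPartner b k ∨ l = tetraPartner c k ∨ l = tetraPartner d k := by
  revert b c d k l; decide

theorem sum_tetraField {M : Type*} [AddCommMonoid M] {b c d : Fin 3} (hbc : b ≠ c) (hbd : b ≠ d)
    (hcd : c ≠ d) (k : TetraField) (f : TetraField → M) :
    ∑ l, f l = f k + (f (tetraPartner b k) + (f (tetraPartner c k) + f (tetraPartner d k))) := by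
  have univ_eq : (Finset.univ : Finset TetraField)
      = {k, tetraPartner b k, tetraPartner c k, tetraPartner d k} := by
    revert b c d k; decide
  rw [univ_eq, Finset.sum_insert, Finset.sum_insert, Finset.sum_insert, Finset.sum_singleton]
  all_goals
    clear univ_eq
    revert b c d k
    simp only [Finset.mem_insert, Finset.mem_singleton]
    decide

/-- A vacuum diagram of the tetrahedral model, with the type `T` of vertices: a Wick contraction
of all their fields in pairs. -/
structure TetraDiagram (T : Type*) where
  /-- the field with which a given field is contracted -/
  contr : T × TetraField → T × TetraField
  contr_contr : ∀ x, contr (contr x) = x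
  contr_ne : ∀ x, contr x ≠ x

namespace TetraDiagram

variable {T : Type*}

/-- The field joined to `x` by the edge of colour `c` of its vertex. -/
def partner (c : Fin 3) (x : T × TetraField) : T × TetraField := (x.1, tetraPartner c x.2)

theorem partner_involutive (c : Fin 3) : Function.Involutive (partner (T := T) c) :=
  fun x => Prod.ext rfl (tetraPartner_involutive c x.2)

@[simp]
theorem partner_partner (c : Fin 3) (x : T × TetraField) : partner c (partner c x) = x :=
  partner_involutive c x

@[simp]
theorem partner_fst (c : Fin 3) (x : T × TetraField) : (partner c x).1 = x.1 := rfl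

theorem partner_ne (c : Fin 3) (x : T × TetraField) : partner c x ≠ x :=
  fun h => tetraPartner_ne c x.2 (congrArg Prod.snd h)

theorem partner_inj {b c : Fin 3} {x : T × TetraField} : partner b x = partner c x ↔ b = c := by
  simp [partner, tetraPartner_inj]

theorem partner_comp {b c d : Fin 3} (hbc : b ≠ c) (hbd : b ≠ d) (hcd : c ≠ d)
    (x : T × TetraField) : partner b (partner c x) = partner d x :=
  Prod.ext rfl (tetraPartner_comp hbc hbd hcd x.2)

theorem cases_of_fst_eq {b c d : Fin 3} (hbc : b ≠ c) (hbd : b ≠ d) (hcd : c ≠ d)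
    {x y : T × TetraField} (h : y.1 = x.1) :
    y = x ∨ y = partner b x ∨ y = partner c x ∨ y = partner d x := by
  simpa [Prod.ext_iff, h, partner] using tetraField_cases hbc hbd hcd x.2 y.2

theorem ncard_fields (S : Set T) : {x : T × TetraField | x.1 ∈ S}.ncard = 4 * S.ncard := by
  have prod_eq : {x : T × TetraField | x.1 ∈ S} = S ×ˢ Set.univ := by ext; simp
  rw [prod_eq, Set.ncard_prod, Set.ncard_univ]
  simp [mul_comm]

variable (G : TetraDiagram T)

/-- The sets of propagators inside `S`, as functions modulo two on the fields. -/
def edgeFun (S : Set T) : Submodule (ZMod 2) (T × TetraField → ZMod 2) :=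
  relationFun (ZMod 2) (fun x y => y = G.contr x) {x | x.1 ∈ S}

/-- The sums modulo two of index loops of colour `c` inside `S`. -/
def loopFun (c : Fin 3) (S : Set T) : Submodule (ZMod 2) (T × TetraField → ZMod 2) :=
  relationFun (ZMod 2) (fun x y => y = G.contr x ∨ y = partner c x) {x | x.1 ∈ S}

/-- The number of index loops of colour `c` inside `S`. -/
noncomputable def loopRank (c : Fin 3) (S : Set T) : ℕ := finrank (ZMod 2) (G.loopFun c S)

/-- The ends of the propagators inside `S`. -/
def innerFields (S : Set T) : Set (T × TetraField) := {x | x.1 ∈ S ∧ (G.contr x).1 ∈ S}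

/-- The vertices of `S` are connected by propagators inside `S`: a function modulo two that is
constant along these propagators is constant on `S`. -/
def IsConnectedOn (S : Set T) : Prop :=
  ∀ g : T → ZMod 2, (∀ x ∈ G.innerFields S, g (G.contr x).1 = g x.1) →
    ∀ s ∈ S, ∀ t ∈ S, g s = g t

/-- The diagram is connected. -/
def IsConnected : Prop := G.IsConnectedOn Set.univ

variable {G} {S : Set T} {b c : Fin 3}

theorem contr_injective : Function.Injective G.contr :=
  Function.Involutive.injective G.contr_contr

theorem contr_eq_iff {x y : T × TetraField} : G.contr x = y ↔ x = G.contr y :=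
  Function.Involutive.eq_iff G.contr_contr

theorem contr_mem_innerFields {x : T × TetraField} :
    G.contr x ∈ G.innerFields S ↔ x ∈ G.innerFields S := by
  simp only [innerFields, Set.mem_ofPred_eq, G.contr_contr, and_comm]

theorem mem_edgeFun {h : T × TetraField → ZMod 2} :
    h ∈ G.edgeFun S ↔ (∀ x, h (G.contr x) = h x) ∧ ∀ x, x.1 ∉ S → h x = 0 := by
  simp [edgeFun, relationFun, eq_comm]

theorem mem_loopFun {h : T × TetraField → ZMod 2} :
    h ∈ G.loopFun c S ↔ h ∈ G.edgeFun S ∧ ∀ x, h (partner c x) = h x := by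
  rw [mem_edgeFun]
  simp [loopFun, relationFun, or_imp, forall_and, eq_comm, and_right_comm]

theorem loopFun_le_edgeFun (c : Fin 3) (S : Set T) : G.loopFun c S ≤ G.edgeFun S :=
  fun _ h => (mem_loopFun.1 h).1

theorem support_subset_innerFields {h : T × TetraField → ZMod 2} (hh : h ∈ G.edgeFun S) :
    h.support ⊆ G.innerFields S := by
  rw [mem_edgeFun] at hh
  refine fun x hx => ⟨by_contra fun hS => hx (hh.2 x hS), by_contra fun hS => hx ?_⟩
  rw [← hh.1]
  exact hh.2 _ hS

theorem two_mul_finrank_edgeFun_le [Finite T] (S : Set T) :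
    2 * finrank (ZMod 2) (G.edgeFun S) ≤ (G.innerFields S).ncard := by
  refine mul_finrank_relationFun_le (fun f => support_subset_innerFields) fun f hf hne => ?_
  obtain ⟨x, hx⟩ := Function.ne_iff.1 hne
  refine (Set.one_lt_ncard (Set.toFinite _)).2 ⟨x, hx, G.contr x, ?_, (G.contr_ne x).symm⟩
  rwa [Function.mem_support, (mem_edgeFun.1 hf).1]

theorem exists_ncard_support_lt [Finite T] {m : ℕ}
    (h : (G.innerFields S).ncard < m * G.loopRank c S) :
    ∃ f ∈ G.loopFun c S, f ≠ 0 ∧ f.support.ncard < m := by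
  by_contra! hm
  exact h.not_ge (mul_finrank_relationFun_le
    (fun f hf => support_subset_innerFields (loopFun_le_edgeFun c S hf)) hm)

theorem indicator_pair_mem_edgeFun {x : T × TetraField} (hx : x ∈ G.innerFields S) :
    Set.indicator {x, G.contr x} 1 ∈ G.edgeFun S := by
  refine mem_edgeFun.2 ⟨fun y => Set.indicator_eq_indicator ?_ rfl,
    fun y hy => Set.indicator_of_notMem ?_ 1⟩
  · rw [Set.mem_insert_iff, Set.mem_singleton_iff, Set.mem_insert_iff, Set.mem_singleton_iff,
      contr_injective.eq_iff, contr_eq_iff, or_comm]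
  · rintro (rfl | rfl)
    exacts [hy hx.1, hy hx.2]

section Pairing

variable [Fintype T]

variable (G) in
/-- The pairing of a set of vertices with a set of propagators inside `S` that counts the ends of
the latter at the former. -/
def pairing (S : Set T) : (T → ZMod 2) →ₗ[ZMod 2] Dual (ZMod 2) (G.edgeFun S) :=
  LinearMap.mk₂ (ZMod 2) (fun g h => ∑ x, h.1 x * g x.1)
    (fun g g' h => by simp [mul_add, Finset.sum_add_distrib])
    (fun a g h => by simp [Finset.mul_sum, mul_left_comm])
    (fun g h h' => by simp [add_mul, Finset.sum_add_distrib])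
    (fun a g h => by simp [Finset.mul_sum, mul_assoc])

theorem pairing_apply (g : T → ZMod 2) (h : G.edgeFun S) :
    G.pairing S g h = ∑ x, h.1 x * g x.1 := rfl

theorem pairing_loopFun (g : T → ZMod 2) {h : T × TetraField → ZMod 2} (hh : h ∈ G.loopFun c S) :
    G.pairing S g ⟨h, loopFun_le_edgeFun c S hh⟩ = 0 :=
  sum_eq_zero_of_involution (partner_involutive c) (partner_ne c) (by simp)
    fun x _ => congrArg (· * g x.1) ((mem_loopFun.1 hh).2 x)

theorem eq_of_pairing_eq_zero {g : T → ZMod 2} (hg : G.pairing S g = 0)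
    {x : T × TetraField} (hx : x ∈ G.innerFields S) : g (G.contr x).1 = g x.1 := by
  classical
  have h := LinearMap.congr_fun hg ⟨_, indicator_pair_mem_edgeFun hx⟩
  simp only [pairing_apply, Set.indicator_apply, Pi.one_apply, ite_mul, one_mul, zero_mul,
    LinearMap.zero_apply, ← Finset.sum_filter] at h
  have pair_eq : (Finset.univ.filter (· ∈ ({x, G.contr x} : Set _))) = {x, G.contr x} := by
    ext; simp
  rw [pair_eq, Finset.sum_pair (G.contr_ne x).symm, CharTwo.add_eq_zero] at h
  exact h.symm

theorem IsConnectedOn.ncard_le_finrank_range_pairing (hS : G.IsConnectedOn S)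
    (hne : S.Nonempty) : S.ncard ≤ finrank (ZMod 2) (LinearMap.range (G.pairing S)) + 1 := by
  obtain ⟨s, hs⟩ := hne
  have rank_nullity := LinearMap.finrank_range_add_finrank_ker (G.pairing S)
  have finrank_ker_le : finrank (ZMod 2) (LinearMap.ker (G.pairing S)) ≤ (insert s Sᶜ).ncard := by
    refine finrank_le_ncard_of_vanish _ _ fun g hg hz => funext fun t => ?_
    by_cases ht : t ∈ S
    · rw [hS g (fun x => eq_of_pairing_eq_zero hg) t ht s hs]
      exact hz s (Set.mem_insert ..)
    · exact hz t (.inr ht)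
  rw [Set.ncard_insert_of_notMem (by simpa using hs)] at finrank_ker_le
  have ncard_compl := Set.ncard_add_ncard_compl S
  rw [finrank_fintype_fun_eq_card, ← Nat.card_eq_fintype_card] at rank_nullity
  omega

theorem range_pairing_le (S : Set T) (b c : Fin 3) :
    LinearMap.range (G.pairing S) ≤
      ((G.loopFun b S ⊔ G.loopFun c S).submoduleOf (G.edgeFun S)).dualAnnihilator := by
  rintro _ ⟨g, rfl⟩
  rw [Submodule.mem_dualAnnihilator]
  rintro ⟨h, hh⟩ hm
  obtain ⟨f, hf, f', hf', rfl⟩ := Submodule.mem_sup.1 (show h ∈ _ from hm)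
  have split : (⟨f + f', hh⟩ : G.edgeFun S) =
    ⟨f, loopFun_le_edgeFun b S hf⟩ + ⟨f', loopFun_le_edgeFun c S hf'⟩ := rfl
  rw [split, map_add, pairing_loopFun g hf, pairing_loopFun g hf', add_zero]

end Pairing

theorem loopRank_add_finrank_dualAnnihilator [Finite T] (S : Set T) (b c : Fin 3) :
    G.loopRank b S + G.loopRank c S + finrank (ZMod 2)
      ((G.loopFun b S ⊔ G.loopFun c S).submoduleOf (G.edgeFun S)).dualAnnihilator =
    finrank (ZMod 2) (G.edgeFun S) +
      finrank (ZMod 2) (G.loopFun b S ⊓ G.loopFun c S : Submodule _ _) := by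
  have sup_inf := Submodule.finrank_sup_add_finrank_inf_eq (G.loopFun b S) (G.loopFun c S)
  have annihilator := Subspace.finrank_add_finrank_dualAnnihilator_eq
    ((G.loopFun b S ⊔ G.loopFun c S).submoduleOf (G.edgeFun S))
  have submoduleOf := (Submodule.submoduleOfEquivOfLe (sup_le (G.loopFun_le_edgeFun b S)
    (G.loopFun_le_edgeFun c S))).finrank_eq
  unfold loopRank
  omega

/-- Euler's inequality for the ribbon graph of two of the three colours. -/
theorem IsConnectedOn.loopRank_add_loopRank_add_ncard_le [Finite T] (hS : G.IsConnectedOn S)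
    (hne : S.Nonempty) (b c : Fin 3) :
    G.loopRank b S + G.loopRank c S + S.ncard ≤ finrank (ZMod 2) (G.edgeFun S) +
      finrank (ZMod 2) (G.loopFun b S ⊓ G.loopFun c S : Submodule _ _) + 1 := by
  have := Fintype.ofFinite T
  have := hS.ncard_le_finrank_range_pairing hne
  have := Submodule.finrank_mono (G.range_pairing_le S b c)
  have := G.loopRank_add_finrank_dualAnnihilator S b c
  omega

/-- In the case of equality in Euler's inequality the ribbon graph of the colours `b` and `c` is a
sphere, so that its cycles are boundaries. -/
theorem IsConnectedOn.mem_loopFun_sup_loopFun [Finite T] (hS : G.IsConnectedOn S)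
    (hne : S.Nonempty)
    (heq : finrank (ZMod 2) (G.edgeFun S) +
      finrank (ZMod 2) (G.loopFun b S ⊓ G.loopFun c S : Submodule _ _) + 1 ≤
      G.loopRank b S + G.loopRank c S + S.ncard)
    {h : T × TetraField → ZMod 2} (hh : h ∈ G.edgeFun S) (ht : ∀ t, ∑ k, h (t, k) = 0) :
    h ∈ G.loopFun b S ⊔ G.loopFun c S := by
  have := Fintype.ofFinite T
  have := hS.ncard_le_finrank_range_pairing hne
  have := G.loopRank_add_finrank_dualAnnihilator S b c
  have range_eq := Submodule.eq_of_le_of_finrank_le (G.range_pairing_le S b c) (by omega)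
  change (⟨h, hh⟩ : G.edgeFun S) ∈ (G.loopFun b S ⊔ G.loopFun c S).submoduleOf (G.edgeFun S)
  rw [← Subspace.dualAnnihilator_dualCoannihilator_eq
    (W := (G.loopFun b S ⊔ G.loopFun c S).submoduleOf (G.edgeFun S)), ← range_eq,
    Submodule.mem_dualCoannihilator]
  rintro _ ⟨g, rfl⟩
  rw [pairing_apply, Fintype.sum_prod_type]
  simp only [← Finset.sum_mul, ht, zero_mul, Finset.sum_const_zero]

theorem IsConnected.apply_eq_of_mem_inf (hG : G.IsConnected) (hbc : b ≠ c)
    {f : T × TetraField → ZMod 2} (hf : f ∈ (G.loopFun b S ⊓ G.loopFun c S : Submodule _ _))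
    (x y : T × TetraField) : f x = f y := by
  have hb := (mem_loopFun.1 hf.1).2
  have hc := (mem_loopFun.1 hf.2).2
  obtain ⟨d, hbd, hcd⟩ := exists_third_colour b c
  have eq_of_fst_eq (x y : T × TetraField) (h : y.1 = x.1) : f y = f x := by
    rcases cases_of_fst_eq hbc hbd hcd h with rfl | rfl | rfl | rfl
    · rfl
    · exact hb x
    · exact hc x
    · rw [← partner_comp hbc hbd hcd, hb, hc]
  calc f x = f (x.1, none) := eq_of_fst_eq _ _ rfl
    _ = f (y.1, none) := hG (fun t => f (t, none)) (fun z _ => by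
        rw [eq_of_fst_eq (G.contr z) (_, none) rfl, eq_of_fst_eq z (_, none) rfl]
        exact (mem_edgeFun.1 (mem_loopFun.1 hf.1).1).1 z) _ trivial _ trivial
    _ = f y := eq_of_fst_eq _ _ rfl

theorem IsConnected.finrank_inf_univ_le [Finite T] [Nonempty T] (hG : G.IsConnected)
    (hbc : b ≠ c) (S : Set T) :
    finrank (ZMod 2) (G.loopFun b S ⊓ G.loopFun c S : Submodule _ _) ≤ 1 := by
  obtain ⟨t⟩ := ‹Nonempty T›
  rw [← Set.ncard_singleton (t, none)]
  exact finrank_le_ncard_of_vanish _ _ fun f hf hz => funext fun x =>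
    (hG.apply_eq_of_mem_inf hbc hf x (t, none)).trans (hz _ rfl)

theorem IsConnected.inf_eq_bot (hG : G.IsConnected) (hbc : b ≠ c) (hS : S ≠ Set.univ) :
    (G.loopFun b S ⊓ G.loopFun c S : Submodule _ _) = ⊥ := by
  obtain ⟨t, ht⟩ := (Set.ne_univ_iff_exists_notMem S).1 hS
  refine (Submodule.eq_bot_iff _).2 fun f hf => funext fun x => ?_
  rw [hG.apply_eq_of_mem_inf hbc hf x (t, none)]
  exact (mem_edgeFun.1 (mem_loopFun.1 hf.1).1).2 _ ht

theorem finrank_edgeFun_univ_le [Finite T] (G : TetraDiagram T) :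
    finrank (ZMod 2) (G.edgeFun Set.univ) ≤ 2 * Nat.card T := by
  have ncard_innerFields : (G.innerFields Set.univ).ncard = 4 * Nat.card T := by
    simpa [innerFields] using ncard_fields (Set.univ : Set T)
  have := G.two_mul_finrank_edgeFun_le Set.univ
  omega

theorem IsConnected.loopRank_add_loopRank_le [Finite T] [Nonempty T] (hG : G.IsConnected)
    (hbc : b ≠ c) :
    G.loopRank b Set.univ + G.loopRank c Set.univ ≤ Nat.card T + 2 := by
  have := IsConnectedOn.loopRank_add_loopRank_add_ncard_le hG Set.univ_nonempty b c
  have := G.finrank_edgeFun_univ_le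
  have := hG.finrank_inf_univ_le hbc Set.univ
  rw [Set.ncard_univ] at *
  omega

variable (G) in
/-- A diagram with `n` vertices is tight if it has at least `3 + 3 n / 2` index loops, the largest
number possible for a connected diagram. -/
def IsTight : Prop := 3 * Nat.card T + 6 ≤ 2 * ∑ c, G.loopRank c Set.univ

variable (G) in
/-- The ribbon graph of any two of the three colours is planar: its cycles, the sets of propagators
with an even number of ends at each vertex, are sums of index loops. -/
def IsPlanar : Prop :=
  ∀ b c : Fin 3, b ≠ c → ∀ h ∈ G.edgeFun Set.univ, (∀ t, ∑ k, h (t, k) = 0) →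
    h ∈ G.loopFun b Set.univ ⊔ G.loopFun c Set.univ

theorem IsTight.le_loopRank_add_loopRank [Finite T] [Nonempty T] (hF : G.IsTight)
    (hG : G.IsConnected) (hbc : b ≠ c) :
    Nat.card T + 2 ≤ G.loopRank b Set.univ + G.loopRank c Set.univ := by
  obtain ⟨d, hbd, hcd⟩ := exists_third_colour b c
  have sum_eq : ∑ c, G.loopRank c Set.univ =
      G.loopRank b Set.univ + G.loopRank c Set.univ + G.loopRank d Set.univ := by
    have : (Finset.univ : Finset (Fin 3)) = {b, c, d} := by revert b c d; decide
    rw [this, Finset.sum_insert (by simp [hbc, hbd]), Finset.sum_pair hcd, add_assoc]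
  have := hG.loopRank_add_loopRank_le hbd
  have := hG.loopRank_add_loopRank_le hcd
  unfold IsTight at hF
  omega

theorem IsTight.isPlanar [Finite T] [Nonempty T] (hF : G.IsTight) (hG : G.IsConnected) :
    G.IsPlanar := by
  intro b c hbc h
  refine IsConnectedOn.mem_loopFun_sup_loopFun hG Set.univ_nonempty ?_
  have := hF.le_loopRank_add_loopRank hG hbc
  have := G.finrank_edgeFun_univ_le
  have := hG.finrank_inf_univ_le hbc Set.univ
  rw [Set.ncard_univ]
  omega

variable (G) in
/-- Exactly two propagators leave `S`, from the fields `u` and `w`. -/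
structure IsCut (S : Set T) (u w : T × TetraField) : Prop where
  ne : u ≠ w
  leaves_iff : ∀ x, x.1 ∈ S ∧ (G.contr x).1 ∉ S ↔ x = u ∨ x = w

namespace IsCut

variable {u w : T × TetraField}

theorem left_mem (h : G.IsCut S u w) : u.1 ∈ S := ((h.leaves_iff u).2 (.inl rfl)).1

theorem contr_left_notMem (h : G.IsCut S u w) : (G.contr u).1 ∉ S :=
  ((h.leaves_iff u).2 (.inl rfl)).2

theorem ne_univ (h : G.IsCut S u w) : S ≠ Set.univ :=
  fun hS => h.contr_left_notMem (hS ▸ trivial)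

theorem compl (h : G.IsCut S u w) : G.IsCut Sᶜ (G.contr u) (G.contr w) where
  ne := contr_injective.ne h.ne
  leaves_iff x := by
    have := h.leaves_iff (G.contr x)
    rw [G.contr_contr, contr_eq_iff, contr_eq_iff] at this
    simpa [and_comm] using this

theorem fields_eq (h : G.IsCut S u w) :
    {x : T × TetraField | x.1 ∈ S} = insert u (insert w (G.innerFields S)) := by
  ext x
  have := h.leaves_iff x
  simp only [innerFields, Set.mem_ofPred_eq, Set.mem_insert_iff]
  tauto

theorem notMem_innerFields (h : G.IsCut S u w) {x : T × TetraField} (hx : x = u ∨ x = w) :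
    x ∉ G.innerFields S :=
  fun hx' => ((h.leaves_iff x).2 hx).2 hx'.2

theorem left_notMem_insert (h : G.IsCut S u w) : u ∉ insert w (G.innerFields S) :=
  not_or.2 ⟨h.ne, h.notMem_innerFields (.inl rfl)⟩

theorem ncard_innerFields_add_two [Finite T] (h : G.IsCut S u w) :
    (G.innerFields S).ncard + 2 = 4 * S.ncard := by
  rw [← ncard_fields, h.fields_eq, Set.ncard_insert_of_notMem h.left_notMem_insert,
    Set.ncard_insert_of_notMem (h.notMem_innerFields (.inr rfl))]

/-- A function without boundary at the vertices sums to zero over the fields of `S`, and the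
contributions of the propagators inside `S` cancel. -/
theorem apply_right_eq_apply_left [Finite T] (h : G.IsCut S u w) {f : T × TetraField → ZMod 2}
    (hf : ∀ x ∈ G.innerFields S, f (G.contr x) = f x) (hc : ∀ x, f (partner c x) = f x) :
    f w = f u := by
  classical
  have := Fintype.ofFinite T
  have sum_fields : ∑ x ∈ {x : T × TetraField | x.1 ∈ S}.toFinset, f x = 0 :=
    sum_eq_zero_of_involution (partner_involutive c) (partner_ne c) (by simp) fun x _ => hc x
  have sum_inner : ∑ x ∈ (G.innerFields S).toFinset, f x = 0 :=
    sum_eq_zero_of_involution G.contr_contr G.contr_ne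
      (fun x => by simpa only [Set.mem_toFinset] using contr_mem_innerFields.2)
      (by simpa using hf)
  simp only [h.fields_eq, Set.toFinset_insert] at sum_fields
  rw [Finset.sum_insert (by simpa using h.left_notMem_insert),
    Finset.sum_insert (by simpa using h.notMem_innerFields (.inr rfl)), sum_inner, add_zero,
    CharTwo.add_eq_zero] at sum_fields
  exact sum_fields.symm

theorem isConnectedOn [Finite T] (h : G.IsCut S u w) (hG : G.IsConnected) :
    G.IsConnectedOn S := by
  classical
  suffices ∀ g : T → ZMod 2, (∀ x ∈ G.innerFields S, g (G.contr x).1 = g x.1) →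
      ∀ t ∈ S, g t = g u.1 from
    fun g hg s hs t ht => (this g hg s hs).trans (this g hg t ht).symm
  intro g hg t ht
  have right_eq : g w.1 = g u.1 :=
    h.apply_right_eq_apply_left (c := 0) (f := fun x => g x.1) hg fun _ => rfl
  have eq_of_leaves x (hx : x.1 ∈ S ∧ (G.contr x).1 ∉ S) : g x.1 = g u.1 := by
    rcases (h.leaves_iff x).1 hx with rfl | rfl
    exacts [rfl, right_eq]
  have extended := hG (fun t => if t ∈ S then g t else g u.1) (fun x _ => by
    by_cases hx : x.1 ∈ S <;> by_cases hx' : (G.contr x).1 ∈ S <;>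
      simp only [hx, hx', if_true, if_false]
    · exact hg x ⟨hx, hx'⟩
    · exact (eq_of_leaves x ⟨hx, hx'⟩).symm
    · exact eq_of_leaves _ ⟨hx', by rwa [G.contr_contr]⟩) t trivial (G.contr u).1 trivial
  simpa [ht, h.contr_left_notMem] using extended

theorem loopRank_add_loopRank_le [Finite T] (h : G.IsCut S u w) (hG : G.IsConnected)
    (hbc : b ≠ c) : G.loopRank b S + G.loopRank c S ≤ S.ncard := by
  have := (h.isConnectedOn hG).loopRank_add_loopRank_add_ncard_le ⟨_, h.left_mem⟩ b c
  rw [hG.inf_eq_bot hbc h.ne_univ, finrank_bot] at this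
  have := G.two_mul_finrank_edgeFun_le S
  have := h.ncard_innerFields_add_two
  omega

end IsCut

theorem indicator_mem_loopFun {f : T × TetraField → ZMod 2} (hf : f ∈ G.loopFun c Set.univ)
    (h : ∀ x, x.1 ∈ S ∧ (G.contr x).1 ∉ S → f x = 0) :
    {x : T × TetraField | x.1 ∈ S}.indicator f ∈ G.loopFun c S := by
  classical
  rw [mem_loopFun, mem_edgeFun] at hf ⊢
  refine ⟨⟨fun x => ?_, fun x hx => Set.indicator_of_notMem
      (show x ∉ {x : T × TetraField | x.1 ∈ S} from hx) f⟩,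
    fun x => Set.indicator_eq_indicator Iff.rfl (hf.2 x)⟩
  simp only [Set.indicator_apply, Set.mem_ofPred_eq, hf.1.1]
  by_cases hx : x.1 ∈ S <;> by_cases hx' : (G.contr x).1 ∈ S <;>
    simp only [hx, hx', if_true, if_false]
  · exact (h x ⟨hx, hx'⟩).symm
  · rw [← hf.1.1]
    exact h _ ⟨hx', by rwa [G.contr_contr]⟩

namespace IsCut

variable {u w : T × TetraField}

theorem mem_loopFun_sup_loopFun_compl [Finite T] (h : G.IsCut S u w)
    {f : T × TetraField → ZMod 2} (hf : f ∈ G.loopFun c Set.univ) (hu : f u = 0) :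
    f ∈ G.loopFun c S ⊔ G.loopFun c Sᶜ := by
  have contr_eq := (mem_edgeFun.1 (mem_loopFun.1 hf).1).1
  have hw : f w = 0 :=
    (h.apply_right_eq_apply_left (fun x _ => contr_eq x) (mem_loopFun.1 hf).2).trans hu
  refine Submodule.mem_sup.2 ⟨_, indicator_mem_loopFun hf fun x hx => ?_, _,
    indicator_mem_loopFun hf fun x hx => ?_,
    Set.indicator_self_add_compl {x : T × TetraField | x.1 ∈ S} f⟩
  · rcases (h.leaves_iff x).1 hx with rfl | rfl <;> assumption
  · rcases (h.compl.leaves_iff x).1 hx with rfl | rfl <;> rw [contr_eq] <;> assumption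

theorem loopRank_univ_le [Finite T] (h : G.IsCut S u w) (c : Fin 3) :
    G.loopRank c Set.univ ≤ G.loopRank c S + G.loopRank c Sᶜ + 1 := by
  have le_sup : (G.loopFun c Set.univ ⊓ LinearMap.ker (LinearMap.proj u) : Submodule _ _) ≤
      G.loopFun c S ⊔ G.loopFun c Sᶜ := fun f hf => h.mem_loopFun_sup_loopFun_compl hf.1 hf.2
  have := finrank_le_finrank_inf_ker_add_one (G.loopFun c Set.univ) (LinearMap.proj u)
  have := Submodule.finrank_mono le_sup
  have := Submodule.finrank_add_le_finrank_add_finrank (G.loopFun c S) (G.loopFun c Sᶜ)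
  unfold loopRank
  omega

theorem three_mul_ncard_le [Finite T] (h : G.IsCut S u w) (hG : G.IsConnected)
    (hF : G.IsTight) : 3 * S.ncard ≤ 2 * ∑ c, G.loopRank c S := by
  have := h.loopRank_univ_le 0
  have := h.loopRank_univ_le 1
  have := h.loopRank_univ_le 2
  have := h.compl.loopRank_add_loopRank_le hG (show (0 : Fin 3) ≠ 1 by decide)
  have := h.compl.loopRank_add_loopRank_le hG (show (0 : Fin 3) ≠ 2 by decide)
  have := h.compl.loopRank_add_loopRank_le hG (show (1 : Fin 3) ≠ 2 by decide)
  have := Set.ncard_add_ncard_compl S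
  unfold IsTight at hF
  rw [Fin.sum_univ_three] at hF ⊢
  omega

end IsCut

end TetraDiagram

theorem ncard_support_eq_sum_val {ι : Type*} [Fintype ι] (f : ι → ZMod 2) :
    f.support.ncard = ∑ x, (f x).val := by
  classical
  rw [Set.ncard_eq_toFinset_card', Finset.card_eq_sum_ones, Function.support, Set.toFinset_ofPred,
    Finset.sum_filter]
  refine Finset.sum_congr rfl fun x _ => ?_
  rcases zmod_two_eq_zero_or_one (f x) with h | h <;> simp [h, ZMod.val_one]

theorem zmod_two_val_add_add_two_mul_val_mul :
    ∀ p q : ZMod 2, (p + q).val + 2 * (p * q).val = p.val + q.val := by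
  decide

theorem four_dvd_sum_val {b c d : Fin 3} (hbc : b ≠ c) (hbd : b ≠ d) (hcd : c ≠ d)
    {f g : TetraField → ZMod 2} (hf : ∀ k, f (tetraPartner c k) = f k)
    (hg : ∀ k, g (tetraPartner d k) = g k)
    (hfg : ∀ k, (f + g) (tetraPartner b k) = (f + g) k) :
    4 ∣ ∑ k, ((f k).val + (g k).val) := by
  have hf' := hf (tetraPartner d none)
  have hg' := hg (tetraPartner c none)
  rw [tetraPartner_comp hcd hbc.symm hbd.symm] at hf'
  rw [tetraPartner_comp hcd.symm hbd.symm hbc.symm] at hg'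
  have sum_eq := hfg none
  have four_dvd : ∀ p q r s : ZMod 2, q + s = p + r →
      4 ∣ p.val + r.val + (q.val + s.val + (p.val + s.val + (q.val + r.val))) := by
    decide
  simp only [sum_tetraField hbc hbd hcd none, Pi.add_apply, hf none, hf', hg none, hg']
    at sum_eq ⊢
  exact four_dvd _ _ _ _ sum_eq

theorem apply_comm_of_ncard_eq_four {X : Type*} {σ τ : X → X} (hσ : Function.Involutive σ)
    (hτ : Function.Involutive τ) (hσ' : ∀ x, σ x ≠ x) (hτ' : ∀ x, τ x ≠ x) {s : Set X}
    (hs : s.ncard = 4) (hσs : ∀ x ∈ s, σ x ∈ s) (hτs : ∀ x ∈ s, τ x ∈ s) {x : X} (hx : x ∈ s)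
    (hne : σ x ≠ τ x) : σ (τ x) = τ (σ x) := by
  have subset : ({x, σ x, τ x, τ (σ x)} : Set X) ⊆ s := by
    rintro y (rfl | rfl | rfl | rfl)
    exacts [hx, hσs x hx, hτs x hx, hτs _ (hσs x hx)]
  have ncard_eq : ({x, σ x, τ x, τ (σ x)} : Set X).ncard = 4 := by
    rw [Set.ncard_insert_of_notMem, Set.ncard_insert_of_notMem, Set.ncard_pair]
    · exact hτ.injective.ne (hσ' x).symm
    · rintro (h | h)
      exacts [hne h, hτ' _ h.symm]
    · rintro (h | h | h)
      exacts [hσ' x h.symm, hτ' x h.symm, hne (hτ.eq_iff.1 h.symm)]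
  have mem := hσs _ (hτs x hx)
  rw [← Set.eq_of_subset_of_ncard_le subset (by rw [hs, ncard_eq])
    (Set.finite_of_ncard_ne_zero (by omega))] at mem
  rcases mem with h | h | h | h
  · exact absurd (hσ.eq_iff.1 h).symm hne
  · exact absurd (hσ.injective h) (hτ' x)
  · exact absurd h (hσ' _)
  · exact h

namespace TetraDiagram

variable {G : TetraDiagram T} {S : Set T} {c d e : Fin 3} {x : T × TetraField}

theorem sum_vertex_eq_zero {h : T × TetraField → ZMod 2} (hh : ∀ x, h (partner c x) = h x)
    (t : T) : ∑ k, h (t, k) = 0 :=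
  sum_eq_zero_of_involution (tetraPartner_involutive c) (tetraPartner_ne c)
    (fun _ _ => Finset.mem_univ _) fun k _ => hh (t, k)

theorem two_dvd_ncard_support [Finite T] {h : T × TetraField → ZMod 2}
    (hh : ∀ x, h (G.contr x) = h x) : 2 ∣ h.support.ncard := by
  have := Fintype.ofFinite T
  rw [ncard_support_eq_sum_val, ← ZMod.natCast_eq_zero_iff]
  simpa using sum_eq_zero_of_involution G.contr_contr G.contr_ne
    (fun x _ => Finset.mem_univ (G.contr x)) fun x _ => hh x

/-- The support of `h` has two fields for each propagator, so `4 ∣` says that the length is even.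
By planarity `h` is a sum `f + g` of loops of the other two colours; the lengths are compared by
counting twice the propagators that these have in common. -/
theorem IsPlanar.four_dvd_ncard_support [Finite T] (hG : G.IsPlanar)
    {h : T × TetraField → ZMod 2} (hh : h ∈ G.loopFun c Set.univ) : 4 ∣ h.support.ncard := by
  have := Fintype.ofFinite T
  obtain ⟨d, e, hcd, hce, hde⟩ : ∃ d e : Fin 3, c ≠ d ∧ c ≠ e ∧ d ≠ e := by
    clear hh; revert c; decide
  rw [mem_loopFun] at hh
  obtain ⟨f, hf, g, hg, rfl⟩ := Submodule.mem_sup.1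
    (hG d e hde h hh.1 (sum_vertex_eq_zero hh.2))
  rw [mem_loopFun] at hf hg
  have two_dvd : 2 ∣ (f * g).support.ncard := two_dvd_ncard_support (G := G) fun x =>
    congrArg₂ (· * ·) ((mem_edgeFun.1 hf.1).1 x) ((mem_edgeFun.1 hg.1).1 x)
  have four_dvd : 4 ∣ ∑ x, ((f x).val + (g x).val) := by
    rw [Fintype.sum_prod_type]
    exact Finset.dvd_sum fun t _ => four_dvd_sum_val hcd hce hde (fun k => hf.2 (t, k))
      (fun k => hg.2 (t, k)) fun k => hh.2 (t, k)
  have sum_eq : ∑ x, ((f + g) x).val + 2 * ∑ x, ((f * g) x).val =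
      ∑ x, ((f x).val + (g x).val) := by
    rw [Finset.mul_sum, ← Finset.sum_add_distrib]
    exact Finset.sum_congr rfl fun x _ => zmod_two_val_add_add_two_mul_val_mul _ _
  rw [ncard_support_eq_sum_val] at two_dvd ⊢
  omega

theorem IsPlanar.contr_ne_partner [Finite T] (hG : G.IsPlanar) (c : Fin 3) (x : T × TetraField) :
    G.contr x ≠ partner c x := by
  intro h
  have h' : partner c (G.contr x) = x := by rw [h, partner_partner]
  have indicator_mem : Set.indicator {x, G.contr x} 1 ∈ G.loopFun c Set.univ := by
    refine mem_loopFun.2 ⟨indicator_pair_mem_edgeFun ⟨trivial, trivial⟩,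
      fun z => Set.indicator_eq_indicator ?_ rfl⟩
    simp only [Set.mem_insert_iff, Set.mem_singleton_iff, (partner_involutive c).eq_iff, h',
      ← h, or_comm]
  have four_dvd := hG.four_dvd_ncard_support indicator_mem
  rw [Set.support_indicator, Function.support_one, Set.inter_univ,
    Set.ncard_pair (G.contr_ne x).symm] at four_dvd
  omega

theorem IsPlanar.exists_contr_partner_eq [Finite T] (hG : G.IsPlanar)
    {h : T × TetraField → ZMod 2} (hh : h ∈ G.loopFun c S) (hne : h ≠ 0)
    (hlt : h.support.ncard < 8) :
    ∃ x ∈ G.innerFields S, G.contr (partner c x) = partner c (G.contr x) := by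
  obtain ⟨x, hx⟩ := Function.ne_iff.1 hne
  have inner := support_subset_innerFields (loopFun_le_edgeFun c S hh)
  rw [mem_loopFun, mem_edgeFun] at hh
  have four_dvd := hG.four_dvd_ncard_support
    (mem_loopFun.2 ⟨mem_edgeFun.2 ⟨hh.1.1, by simp⟩, hh.2⟩)
  have pos := (Set.ncard_pos (Set.toFinite h.support)).2 ⟨x, hx⟩
  exact ⟨x, inner hx, apply_comm_of_ncard_eq_four G.contr_contr (partner_involutive c) G.contr_ne
    (partner_ne c) (s := h.support) (by omega)
    (fun y hy => by rwa [Function.mem_support, hh.1.1])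
    (fun y hy => by rwa [Function.mem_support, hh.2]) hx (hG.contr_ne_partner c x)⟩

variable (G) in
/-- The propagator at `x` and the one at the field joined to `x` by the edge of colour `c` form an
index loop of colour `c` through two different vertices. -/
def IsDipole (c : Fin 3) (x : T × TetraField) : Prop :=
  x.1 ≠ (G.contr x).1 ∧ G.contr (partner c x) = partner c (G.contr x)

variable (G) in
/-- The diagram contains an elementary melon: two vertices joined by the propagator at `x`, with
dipoles at `x` of all colours but `m`. -/
def HasMelon : Prop := ∃ x m, ∀ c, c ≠ m → G.IsDipole c x

theorem IsDipole.contr (h : G.IsDipole c x) : G.IsDipole c (G.contr x) := by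
  refine ⟨?_, ?_⟩
  · rw [G.contr_contr]
    exact h.1.symm
  · rw [← h.2, G.contr_contr, G.contr_contr]

variable (G) in
/-- The four fields of a dipole. -/
def dipoleFields (c : Fin 3) (x : T × TetraField) : Set (T × TetraField) :=
  {z | z = x ∨ z = partner c x ∨ z = G.contr x ∨ z = partner c (G.contr x)}

theorem dipoleFields_contr (c : Fin 3) (x : T × TetraField) :
    G.dipoleFields c (G.contr x) = G.dipoleFields c x := by
  ext z
  simp only [dipoleFields, G.contr_contr, Set.mem_ofPred_eq]
  tauto

theorem IsDipole.indicator_mem_loopFun (h : G.IsDipole c x) :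
    (G.dipoleFields c x).indicator 1 ∈ G.loopFun c Set.univ := by
  refine mem_loopFun.2 ⟨mem_edgeFun.2 ⟨fun z => Set.indicator_eq_indicator ?_ rfl,
    fun z hz => absurd (Set.mem_univ z.1) hz⟩, fun z => Set.indicator_eq_indicator ?_ rfl⟩
  · simp only [dipoleFields, Set.mem_ofPred_eq, contr_eq_iff, G.contr_contr, ← h.2]
    tauto
  · simp only [dipoleFields, Set.mem_ofPred_eq, (partner_involutive c).eq_iff, partner_partner]
    tauto

theorem IsDipole.partner_notMem_dipoleFields (h : G.IsDipole c x) (hcd : c ≠ d) :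
    partner d x ∉ G.dipoleFields c x := by
  rintro (h' | h' | h' | h')
  · exact partner_ne d x h'
  · exact hcd (partner_inj.1 h').symm
  all_goals exact h.1 (by simpa using congrArg Prod.fst h')

variable (G) in
/-- `A` consists of the fields on one side of a closed curve that passes through the propagator at
`x` and through the two vertices joined by it; on this side of the curve these vertices have,
besides the ends of this propagator, only the fields joined to them by the edges of colour `d`. -/
structure IsSide (d : Fin 3) (x : T × TetraField) (A : Set (T × TetraField)) : Prop where
  contr_mem_iff : ∀ z, G.contr z ∈ A ↔ z ∈ A
  mem_iff : ∀ z, z.1 = x.1 → (z ∈ A ↔ z = x ∨ z = partner d x)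
  mem_iff_contr : ∀ z, z.1 = (G.contr x).1 → (z ∈ A ↔ z = G.contr x ∨ z = partner d (G.contr x))
  mem_iff_mem : ∀ y z, y.1 ≠ x.1 → y.1 ≠ (G.contr x).1 → z.1 = y.1 → (z ∈ A ↔ y ∈ A)

theorem IsDipole.isSide (h : G.IsDipole c x) (hcd : c ≠ d) (hce : c ≠ e) (hde : d ≠ e)
    {A B : Set (T × TetraField)} (hA : ∀ z, G.contr z ∈ A ↔ z ∈ A)
    (hAd : ∀ z, partner d z ∈ A ↔ z ∈ A) (hBe : ∀ z, partner e z ∈ B ↔ z ∈ B)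
    (hAB : ∀ z, (z ∈ A ↔ z ∈ B) ↔ z ∈ G.dipoleFields c x) (hx : x ∈ A) : G.IsSide d x A := by
  have mem_iff {y : T × TetraField} (hy : G.IsDipole c y)
      (hAB : ∀ z, (z ∈ A ↔ z ∈ B) ↔ z ∈ G.dipoleFields c y) (hyA : y ∈ A) (z : T × TetraField)
      (hz : z.1 = y.1) : z ∈ A ↔ z = y ∨ z = partner d y := by
    have partner_e_mem : partner e y ∈ B := (hBe y).2 (((hAB y).2 (.inl rfl)).1 hyA)
    have partner_e_notMem : partner e y ∉ A := fun he =>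
      hy.partner_notMem_dipoleFields hce ((hAB _).1 (iff_of_true he partner_e_mem))
    have partner_c_notMem : partner c y ∉ A := by
      rwa [← partner_comp hde hcd.symm hce.symm, hAd]
    refine ⟨fun hzA => ?_, by rintro (rfl | rfl) <;> simpa only [hAd]⟩
    rcases cases_of_fst_eq hcd hce hde hz with rfl | rfl | rfl | rfl
    exacts [.inl rfl, absurd hzA partner_c_notMem, .inr rfl, absurd hzA partner_e_notMem]
  refine ⟨hA, mem_iff h hAB hx, mem_iff h.contr (by rwa [dipoleFields_contr]) ((hA x).2 hx),
    fun y z hyx hyx' hz => ?_⟩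
  have mem_iff_notMem {z : T × TetraField} (hz : z.1 = y.1) : z ∈ A ↔ z ∉ B := by
    have notMem : z ∉ G.dipoleFields c x := by
      rintro (rfl | rfl | rfl | rfl)
      exacts [hyx hz.symm, hyx hz.symm, hyx' hz.symm, hyx' hz.symm]
    have := hAB z
    tauto
  have partner_e_mem_iff : partner e y ∈ A ↔ y ∈ A := by
    rw [mem_iff_notMem rfl, mem_iff_notMem (partner_fst e y), hBe]
  rcases cases_of_fst_eq hcd hce hde hz with rfl | rfl | rfl | rfl
  · rfl
  · rw [← partner_comp hde hcd.symm hce.symm, hAd, partner_e_mem_iff]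
  · exact hAd y
  · exact partner_e_mem_iff

theorem IsPlanar.exists_isSide (hG : G.IsPlanar) (hx : G.IsDipole c x) :
    ∃ d e, c ≠ d ∧ c ≠ e ∧ d ≠ e ∧ ∃ A B, G.IsSide d x A ∧ G.IsSide e x B ∧
      ∀ z, z.1 ≠ x.1 → z.1 ≠ (G.contr x).1 → (z ∈ A ↔ z ∉ B) := by
  have indicator_mem := mem_loopFun.1 hx.indicator_mem_loopFun
  obtain ⟨d, e, hcd, hce, hde, f, hf, g, hg, hfg, hfx⟩ : ∃ d e, c ≠ d ∧ c ≠ e ∧ d ≠ e ∧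
      ∃ f ∈ G.loopFun d Set.univ, ∃ g ∈ G.loopFun e Set.univ,
        f + g = (G.dipoleFields c x).indicator 1 ∧ f x = 1 := by
    obtain ⟨d, e, hcd, hce, hde⟩ : ∃ d e : Fin 3, c ≠ d ∧ c ≠ e ∧ d ≠ e := by
      clear * -; revert c; decide
    obtain ⟨f, hf, g, hg, hfg⟩ := Submodule.mem_sup.1
      (hG d e hde _ indicator_mem.1 (sum_vertex_eq_zero indicator_mem.2))
    rcases zmod_two_eq_zero_or_one (f x) with h | h
    · refine ⟨e, d, hce, hcd, hde.symm, g, hg, f, hf, by rw [add_comm, hfg], ?_⟩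
      simpa [h, dipoleFields] using congrFun hfg x
    · exact ⟨d, e, hcd, hce, hde, f, hf, g, hg, hfg, h⟩
  rw [mem_loopFun, mem_edgeFun] at hf hg
  have compl_iff z : (f z = 1 ↔ g z = 0) ↔ z ∈ G.dipoleFields c x := by
    have := congrFun hfg z
    by_cases hz : z ∈ G.dipoleFields c x <;>
      rcases zmod_two_eq_zero_or_one (f z) with h | h <;>
      rcases zmod_two_eq_zero_or_one (g z) with h' | h' <;>
      simp_all [CharTwo.add_self_eq_zero]
  refine ⟨d, e, hcd, hce, hde, {z | f z = 1}, {z | g z = 0},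
    hx.isSide hcd hce hde (B := {z | g z = 0}) ?_ ?_ ?_ compl_iff hfx,
    hx.isSide hce hcd hde.symm (B := {z | f z = 1}) ?_ ?_ ?_
      (fun z => by rw [← compl_iff z]; exact Iff.comm) (((compl_iff x).2 (.inl rfl)).1 hfx),
    fun z hz hz' => ?_⟩
  any_goals simp only [Set.mem_ofPred_eq, hf.1.1, hf.2, hg.1.1, hg.2, implies_true]
  have notMem : z ∉ G.dipoleFields c x := by
    rintro (rfl | rfl | rfl | rfl)
    exacts [hz rfl, hz rfl, hz' rfl, hz' rfl]
  have := compl_iff z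
  tauto

variable (G) in
/-- The vertices other than the two ends of the propagator at `x` whose fields belong to `A`. -/
def sideVertices (x : T × TetraField) (A : Set (T × TetraField)) : Set T :=
  {s | s ≠ x.1 ∧ s ≠ (G.contr x).1 ∧ (s, none) ∈ A}

namespace IsSide

variable {A : Set (T × TetraField)}

theorem contr (h : G.IsSide d x A) : G.IsSide d (G.contr x) A where
  contr_mem_iff := h.contr_mem_iff
  mem_iff := h.mem_iff_contr
  mem_iff_contr := by simpa only [G.contr_contr] using h.mem_iff
  mem_iff_mem y z hy hy' := h.mem_iff_mem y z (by rwa [G.contr_contr] at hy') hy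

theorem mem_sideVertices (h : G.IsSide d x A) {z : T × TetraField} :
    z.1 ∈ G.sideVertices x A ↔ z.1 ≠ x.1 ∧ z.1 ≠ (G.contr x).1 ∧ z ∈ A := by
  simp only [sideVertices, Set.mem_ofPred_eq]
  exact and_congr_right fun hz => and_congr_right fun hz' =>
    h.mem_iff_mem z (z.1, none) hz hz' rfl

theorem contr_partner_mem_sideVertices (h : G.IsSide d x A) (hx : x.1 ≠ (G.contr x).1)
    (hne : G.contr (partner d x) ≠ partner d (G.contr x)) :
    (G.contr (partner d x)).1 ∈ G.sideVertices x A := by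
  have mem : G.contr (partner d x) ∈ A :=
    (h.contr_mem_iff _).2 ((h.mem_iff (partner d x) rfl).2 (.inr rfl))
  refine h.mem_sideVertices.2 ⟨fun hfst => ?_, fun hfst => ?_, mem⟩
  · rcases (h.mem_iff _ hfst).1 mem with hz | hz
    · exact hx (by simpa using congrArg Prod.fst (contr_eq_iff.1 hz))
    · exact G.contr_ne _ hz
  · rcases (h.mem_iff_contr _ hfst).1 mem with hz | hz
    · exact partner_ne d x (contr_injective hz)
    · exact hne hz

theorem isCut (h : G.IsSide d x A) (hx : x.1 ≠ (G.contr x).1)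
    (hne : G.contr (partner d x) ≠ partner d (G.contr x)) :
    G.IsCut (G.sideVertices x A) (G.contr (partner d x)) (G.contr (partner d (G.contr x))) where
  ne h' := hx (by simpa using congrArg Prod.fst (contr_injective h'))
  leaves_iff y := by
    constructor
    · rintro ⟨hy, hy'⟩
      rw [h.mem_sideVertices] at hy hy'
      rw [← contr_eq_iff, ← contr_eq_iff]
      have contr_mem := (h.contr_mem_iff y).2 hy.2.2
      by_cases hfst : (G.contr y).1 = x.1
      · rcases (h.mem_iff _ hfst).1 contr_mem with hz | hz
        · exact absurd (congrArg Prod.fst (contr_eq_iff.1 hz)) hy.2.1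
        · exact .inl hz
      · rcases (h.mem_iff_contr _ (by tauto)).1 contr_mem with hz | hz
        · exact absurd (congrArg Prod.fst (contr_injective hz)) hy.1
        · exact .inr hz
    · rintro (rfl | rfl)
      · rw [G.contr_contr]
        exact ⟨h.contr_partner_mem_sideVertices hx hne, fun h' => h'.1 rfl⟩
      · have := h.contr.contr_partner_mem_sideVertices (by rw [G.contr_contr]; exact hx.symm)
          (by rw [G.contr_contr]; exact fun h' => hne (contr_eq_iff.1 h').symm)
        rw [h.mem_sideVertices]
        rw [h.contr.mem_sideVertices, G.contr_contr] at this
        exact ⟨⟨this.2.1, this.1, this.2.2⟩, fun h' => h'.2.1 (by rw [G.contr_contr]; rfl)⟩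

end IsSide

theorem IsPlanar.hasMelon_or_exists_isCut (hG : G.IsPlanar) (hx : G.IsDipole c x) :
    G.HasMelon ∨ ∃ M : Set T, (∃ u w, G.IsCut M u w) ∧
      (∃ u w, G.IsCut (M ∪ {x.1, (G.contr x).1})ᶜ u w) ∧ x.1 ∉ M ∧
      ∀ y, y.1 ∈ M → (G.contr y).1 ∈ M ∪ {x.1, (G.contr x).1} := by
  obtain ⟨d, e, hcd, hce, hde, A, B, hA, hB, hAB⟩ := hG.exists_isSide hx
  by_cases hd : G.contr (partner d x) = partner d (G.contr x)
  · refine .inl ⟨x, e, fun a ha => ?_⟩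
    obtain rfl | rfl : a = c ∨ a = d := by
      clear * - ha hcd hce hde; revert a c d e; decide
    exacts [hx, ⟨hx.1, hd⟩]
  by_cases he : G.contr (partner e x) = partner e (G.contr x)
  · refine .inl ⟨x, d, fun a ha => ?_⟩
    obtain rfl | rfl : a = c ∨ a = e := by
      clear * - ha hcd hce hde; revert a c d e; decide
    exacts [hx, ⟨hx.1, he⟩]
  have sideVertices_eq : G.sideVertices x B = (G.sideVertices x A ∪ {x.1, (G.contr x).1})ᶜ := by
    ext s
    have := hAB (s, none)
    simp only [sideVertices, Set.mem_compl_iff, Set.mem_union, Set.mem_ofPred_eq,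
      Set.mem_insert_iff, Set.mem_singleton_iff]
    tauto
  refine .inr ⟨G.sideVertices x A, ⟨_, _, hA.isCut hx.1 hd⟩, ⟨_, _, sideVertices_eq ▸
    hB.isCut hx.1 he⟩, fun h => h.1 rfl, fun y hy => ?_⟩
  have contr_mem := (hA.contr_mem_iff y).2 (hA.mem_sideVertices.1 hy).2.2
  rw [Set.mem_union, hA.mem_sideVertices, Set.mem_insert_iff, Set.mem_singleton_iff]
  tauto

variable (G) in
/-- The sets of vertices in which one looks for a melon: everything, or one side of a cut. -/
def IsPiece (S : Set T) : Prop := S = Set.univ ∨ ∃ u w, G.IsCut S u w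

theorem IsPiece.exists_ncard_innerFields_lt [Finite T] [Nonempty T] (hS : G.IsPiece S)
    (hG : G.IsConnected) (hF : G.IsTight) :
    ∃ c, (G.innerFields S).ncard < 8 * G.loopRank c S := by
  by_contra! hle
  have h0 := hle 0
  have h1 := hle 1
  have h2 := hle 2
  rcases hS with rfl | ⟨u, w, hS⟩
  · have := ncard_fields (Set.univ : Set T)
    simp only [IsTight, innerFields, Set.mem_univ, and_self, Fin.sum_univ_three,
      Set.ncard_univ] at *
    omega
  · have := hS.ncard_innerFields_add_two
    have := hS.three_mul_ncard_le hG hF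
    rw [Fin.sum_univ_three] at this
    omega

theorem IsPiece.subset_or_subset [Finite T] (hS : G.IsPiece S) (hG : G.IsConnected) {M A : Set T}
    (hA : A ⊆ S) (hM : ∀ y : T × TetraField, y.1 ∈ M → (G.contr y).1 ∈ M ∪ A) :
    M ⊆ S ∨ (M ∪ A)ᶜ ⊆ S := by
  rcases hS with rfl | ⟨u, w, hS⟩
  · exact .inl (Set.subset_univ M)
  have mem_of_mem (y : T × TetraField) (hy : (G.contr y).1 ∈ Sᶜ) (hyM : y.1 ∈ M) :
      (G.contr y).1 ∈ M := (hM y hyM).resolve_right fun h => hy (hA h)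
  have constant := hS.compl.isConnectedOn hG (M.indicator 1) fun y hy =>
    Set.indicator_eq_indicator ⟨fun h => by
      simpa only [G.contr_contr] using mem_of_mem (G.contr y) (by rw [G.contr_contr]; exact hy.1) h,
      mem_of_mem y hy.2⟩ rfl
  by_contra! h
  obtain ⟨⟨s, hsM, hsS⟩, t, htM, htS⟩ := h.imp Set.not_subset.1 Set.not_subset.1
  have := constant s hsS t htS
  rw [Set.indicator_of_mem hsM, Set.indicator_of_notMem fun h => htM (.inl h)] at this
  exact one_ne_zero this

/-- A vertex all of whose fields are contracted with each other is a whole component. -/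
theorem IsConnected.fst_ne_contr_fst (hG : G.IsConnected) (hT : Even (Nat.card T))
    (hx : G.contr x ≠ partner c x) (hc : G.contr (partner c x) = partner c (G.contr x)) :
    x.1 ≠ (G.contr x).1 := by
  intro h
  obtain ⟨d, hcd, hd⟩ : ∃ d, c ≠ d ∧ G.contr x = partner d x := by
    obtain ⟨d, e, hcd, hce, hde⟩ : ∃ d e : Fin 3, c ≠ d ∧ c ≠ e ∧ d ≠ e := by
      clear * -; revert c; decide
    rcases cases_of_fst_eq hcd hce hde h.symm with h' | h' | h' | h'
    exacts [absurd h' (G.contr_ne x), absurd h' hx, ⟨d, hcd, h'⟩, ⟨e, hce, h'⟩]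
  obtain ⟨e, hce, hde⟩ := exists_third_colour c d
  have contr_fst_of_fst (y : T × TetraField) (hy : y.1 = x.1) : (G.contr y).1 = x.1 := by
    rcases cases_of_fst_eq hcd hce hde hy with rfl | rfl | rfl | rfl
    · exact h.symm
    · rw [hc, partner_fst, h]
    · rw [← hd, G.contr_contr]
    · rw [← partner_comp hcd hce hde, ← hd, ← hc, G.contr_contr, partner_fst]
  have eq_fst (t : T) : t = x.1 := by
    by_contra ht
    have constant := hG (Set.indicator {x.1} 1) (fun y _ => Set.indicator_eq_indicator
      ⟨fun hy => (congrArg Prod.fst (G.contr_contr y)).symm.trans (contr_fst_of_fst _ hy),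
        contr_fst_of_fst y⟩ rfl) t trivial x.1 trivial
    simp [ht] at constant
  have card_eq : Nat.card T = 1 := Nat.card_eq_one_iff_unique.2
    ⟨⟨fun s t => (eq_fst s).trans (eq_fst t).symm⟩, ⟨x.1⟩⟩
  exact Nat.not_even_one (card_eq ▸ hT)

theorem IsPiece.hasMelon [Finite T] [Nonempty T] (hG : G.IsConnected) (hF : G.IsTight)
    (hT : Even (Nat.card T)) (hS : G.IsPiece S) : G.HasMelon := by
  induction hn : S.ncard using Nat.strong_induction_on generalizing S with
  | _ n ih =>
    obtain ⟨c, hc⟩ := hS.exists_ncard_innerFields_lt hG hF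
    obtain ⟨f, hf, hne, hlt⟩ := exists_ncard_support_lt hc
    have hP := hF.isPlanar hG
    obtain ⟨x, hx, hxc⟩ := hP.exists_contr_partner_eq hf hne hlt
    have hxx := hG.fst_ne_contr_fst hT (hP.contr_ne_partner c x) hxc
    have hasMelon_of_subset {M : Set T} (hM : ∃ u w, G.IsCut M u w) (hxM : x.1 ∉ M)
        (hMS : M ⊆ S) : G.HasMelon :=
      ih M.ncard (hn ▸ Set.ncard_lt_ncard ⟨hMS, fun h => hxM (h hx.1)⟩) (.inr hM) rfl
    rcases hP.hasMelon_or_exists_isCut ⟨hxx, hxc⟩ with h | ⟨M, hM, hN, hxM, leaves⟩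
    · exact h
    rcases hS.subset_or_subset hG (Set.pair_subset hx.1 hx.2) leaves with hMS | hNS
    · exact hasMelon_of_subset hM hxM hMS
    · exact hasMelon_of_subset hN (by simp) hNS

theorem IsTight.hasMelon [Finite T] [Nonempty T] (hF : G.IsTight) (hG : G.IsConnected)
    (hT : Even (Nat.card T)) : G.HasMelon :=
  IsPiece.hasMelon hG hF hT (S := Set.univ) (.inl rfl)

end TetraDiagram

theorem finrank_inf_ker_add_one {K V : Type*} [Field K] [AddCommGroup V] [Module K V]
    [FiniteDimensional K V] (P : Submodule K V) {φ : Dual K V} {p : V} (hp : p ∈ P)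
    (hφ : φ p ≠ 0) : finrank K (P ⊓ LinearMap.ker φ : Submodule K V) + 1 = finrank K P := by
  have restrict_ne : φ.domRestrict P ≠ 0 := fun h => hφ (LinearMap.congr_fun h ⟨p, hp⟩)
  rw [← Module.Dual.finrank_ker_add_one_of_ne_zero restrict_ne, LinearMap.ker_domRestrict,
    ← Submodule.map_comap_subtype, Submodule.finrank_map_subtype_eq]

theorem finrank_eq_of_comp_equiv {K X Y : Type*} [Field K] (e : X ≃ Y)
    {P : Submodule K (X → K)} {Q : Submodule K (Y → K)} (h : ∀ g, g ∘ e ∈ P ↔ g ∈ Q) :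
    finrank K P = finrank K Q := by
  let φ := LinearEquiv.funCongrLeft K K e
  obtain rfl : Q = P.comap φ.toLinearMap := Submodule.ext fun g => (h g).symm
  exact (φ.ofSubmodule' P).finrank_eq.symm

theorem prismPartner_prismPartner (c : PrismColour) (x : PrismField) :
    prismPartner c (prismPartner c x) = x := by
  revert c x; decide

theorem prismPartner_ne (c : PrismColour) (x : PrismField) : prismPartner c x ≠ x := by
  revert c x; decide

theorem prismPartner_rung (c : PrismColour) (s : Bool) : prismPartner c (s, c) = (!s, c) := by
  simp [prismPartner]

theorem prismPartner_corner (c d : PrismColour) (s : Bool) :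
    prismPartner c (prismPartner d (s, c)) = (s, d) := by
  revert c d s; decide

theorem eq_of_prismPartner_eq {α : Type*} {f : PrismField → α}
    (h : ∀ c x, f (prismPartner c x) = f x) (x y : PrismField) : f x = f y := by
  have corner s c d : f (s, d) = f (s, c) := by rw [← prismPartner_corner c d s, h, h]
  obtain ⟨s, c⟩ := x
  obtain ⟨t, d⟩ := y
  obtain rfl | rfl := Bool.eq_or_eq_not t s
  · exact corner t d c
  · rw [corner (!s) c d, ← prismPartner_rung, h]

namespace PrismDiagram

variable {D D' E : PrismDiagram} {C : Set PrismColour}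

/-- The functions modulo two on the fields that are constant along propagators and along
the edges of the interaction vertices with colours in `C`. -/
def lineFun (D : PrismDiagram) (C : Set PrismColour) : Submodule (ZMod 2) (D.HalfEdge → ZMod 2) :=
  relationFun (ZMod 2) (fun x y => y = D.contr x ∨ ∃ c ∈ C, y = (x.1, prismPartner c x.2)) Set.univ

/-- The number of components of the graph formed by the propagators, the edges of the interaction
vertices with colours in `C`, and the closed propagators. -/
noncomputable def count (D : PrismDiagram) (C : Set PrismColour) : ℕ :=
  finrank (ZMod 2) (D.lineFun C) + D.rings

theorem contr_injective (D : PrismDiagram) : Function.Injective D.contr :=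
  Function.LeftInverse.injective D.contr_contr

theorem mem_lineFun {g : D.HalfEdge → ZMod 2} : g ∈ D.lineFun C ↔
    (∀ x, g (D.contr x) = g x) ∧ ∀ c ∈ C, ∀ v i, g (v, prismPartner c i) = g (v, i) := by
  constructor
  · rintro ⟨h, -⟩
    exact ⟨fun x => (h _ _ (.inl rfl)).symm,
      fun c hc v i => (h (v, i) _ (.inr ⟨c, hc, rfl⟩)).symm⟩
  · rintro ⟨h, h'⟩
    refine ⟨?_, fun x hx => (hx trivial).elim⟩
    rintro x y (rfl | ⟨c, hc, rfl⟩)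
    exacts [(h x).symm, (h' c hc x.1 x.2).symm]

theorem loops_eq_count (D : PrismDiagram) (c : PrismColour) : D.loops c = D.count {c} := by
  have strand_eq : D.Strand c =
      fun x y => y = D.contr x ∨ ∃ d ∈ ({c} : Set PrismColour), y = (x.1, prismPartner d x.2) := by
    ext x y
    simp [Strand]
  rw [loops, count, lineFun, finrank_relationFun_univ, strand_eq]

theorem totalLoops_eq_sum_count (D : PrismDiagram) : D.totalLoops = ∑ c, D.count {c} :=
  Finset.sum_congr rfl fun c _ => D.loops_eq_count c

theorem apply_eq_of_mem_lineFun_univ {g : D.HalfEdge → ZMod 2} (hg : g ∈ D.lineFun Set.univ)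
    (v : D.V) (i j : PrismField) : g (v, i) = g (v, j) :=
  eq_of_prismPartner_eq (f := fun i => g (v, i))
    (fun c x => (mem_lineFun.1 hg).2 c trivial v x) i j

theorem connected_iff_count_eq_one : D.Connected ↔ D.count Set.univ = 1 := by
  rw [Connected, count, ← finrank_relationFun_univ (ZMod 2) D.Adj]
  let e : relationFun (ZMod 2) D.Adj Set.univ ≃ₗ[ZMod 2] D.lineFun Set.univ :=
    { toFun := fun g => ⟨fun x => g.1 x.1, mem_lineFun.2
        ⟨fun x => (g.2.1 _ _ ⟨x.2, (D.contr x).2, rfl⟩).symm, fun _ _ _ _ => rfl⟩⟩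
      map_add' := fun _ _ => rfl
      map_smul' := fun _ _ => rfl
      invFun := fun g => ⟨fun v => g.1 (v, (false, 0)), by
        refine ⟨?_, fun v hv => (hv trivial).elim⟩
        rintro v w ⟨i, j, h⟩
        change g.1 (v, _) = g.1 (w, _)
        rw [apply_eq_of_mem_lineFun_univ g.2 v _ i, apply_eq_of_mem_lineFun_univ g.2 w _ j, ← h]
        exact ((mem_lineFun.1 g.2).1 _).symm⟩
      left_inv := fun _ => rfl
      right_inv := fun g => Subtype.ext
        (funext fun x => apply_eq_of_mem_lineFun_univ g.2 x.1 _ x.2) }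
  rw [e.finrank_eq]

namespace Iso

theorem symm (h : Iso D D') : Iso D' D := by
  obtain ⟨hr, e, he, hp⟩ := h
  refine ⟨hr.symm, e.symm, fun x => ?_, fun c x => ?_⟩
  · rw [Equiv.symm_apply_eq, he, Equiv.apply_symm_apply]
  · rw [Equiv.symm_apply_eq, hp, Equiv.apply_symm_apply]

theorem trans {D'' : PrismDiagram} (h : Iso D D') (h' : Iso D' D'') : Iso D D'' := by
  obtain ⟨hr, e, he, hp⟩ := h
  obtain ⟨hr', e', he', hp'⟩ := h'
  exact ⟨hr.trans hr', e.trans e', fun x => by simp [he, he'],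
    fun c x => (congrArg e' (hp c x)).trans (hp' c (e x))⟩

theorem count_eq (h : Iso D D') (C : Set PrismColour) : D.count C = D'.count C := by
  obtain ⟨hr, e, he, hp⟩ := h
  rw [count, count, hr, finrank_eq_of_comp_equiv e]
  intro g
  simp only [mem_lineFun, Function.comp_apply, he]
  refine and_congr (e.forall_congr_left.trans (by simp)) (forall₂_congr fun c _ => ?_)
  rw [← Prod.forall (p := fun x : D.HalfEdge => g (e (x.1, prismPartner c x.2)) = g (e x)),
    ← Prod.forall (p := fun x : D'.HalfEdge => g (x.1, prismPartner c x.2) = g x)]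
  simp only [hp]
  exact e.forall_congr_left.trans (by simp)

theorem numVertices_eq (h : Iso D D') : D.numVertices = D'.numVertices := by
  obtain ⟨-, e, -⟩ := h
  have card_eq := Nat.card_congr e
  rw [Nat.card_prod D.V, Nat.card_prod D'.V] at card_eq
  exact Nat.eq_of_mul_eq_mul_right (Nat.card_pos (α := PrismField)) card_eq

end Iso

theorem left_injective : Function.Injective (left E : D.HalfEdge → (D.union E).HalfEdge) :=
  fun _ _ h => Prod.ext (Sum.inl_injective (congrArg Prod.fst h)) (congrArg (fun z => z.2) h)

theorem left_ne_right (x : D.HalfEdge) (a : E.HalfEdge) : left E x ≠ right D a :=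
  fun h => Sum.inl_ne_inr (congrArg Prod.fst h)

theorem union_contr_left (x : D.HalfEdge) : (D.union E).contr (left E x) = left E (D.contr x) :=
  rfl

theorem numVertices_union (D E : PrismDiagram) :
    (D.union E).numVertices = D.numVertices + E.numVertices := Nat.card_sum

theorem mem_lineFun_union {g : (D.union E).HalfEdge → ZMod 2} :
    g ∈ (D.union E).lineFun C ↔ g ∘ left E ∈ D.lineFun C ∧ g ∘ right D ∈ E.lineFun C := by
  simp only [mem_lineFun]
  constructor
  · rintro ⟨h, h'⟩
    exact ⟨⟨fun x => h (left E x), fun c hc v i => h' c hc (Sum.inl v) i⟩,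
      ⟨fun x => h (right D x), fun c hc v i => h' c hc (Sum.inr v) i⟩⟩
  · rintro ⟨⟨h, h'⟩, ⟨k, k'⟩⟩
    constructor
    · rintro ⟨v | w, i⟩
      exacts [h (v, i), k (w, i)]
    · rintro c hc (v | w) i
      exacts [h' c hc v i, k' c hc w i]

theorem count_union (D E : PrismDiagram) (C : Set PrismColour) :
    (D.union E).count C = D.count C + E.count C := by
  let φ : (D.union E).lineFun C ≃ₗ[ZMod 2] D.lineFun C × E.lineFun C :=
    { toFun := fun g => (⟨_, (mem_lineFun_union.1 g.2).1⟩, ⟨_, (mem_lineFun_union.1 g.2).2⟩)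
      map_add' := fun _ _ => rfl
      map_smul' := fun _ _ => rfl
      invFun := fun p => ⟨fun x => Sum.elim (fun v => p.1.1 (v, x.2)) (fun w => p.2.1 (w, x.2)) x.1,
        mem_lineFun_union.2 ⟨p.1.2, p.2.2⟩⟩
      left_inv := fun g => Subtype.ext (funext fun x => by obtain ⟨v | w, i⟩ := x <;> rfl)
      right_inv := fun _ => rfl }
  have rings_union : (D.union E).rings = D.rings + E.rings := rfl
  rw [count, count, count, φ.finrank_eq, finrank_prod, rings_union]
  ring

theorem count_replaceRing (E : PrismDiagram) (hD : 0 < D.rings) (C : Set PrismColour) :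
    (D.replaceRing E).count C + 1 = D.count C + E.count C := by
  have rings_eq : (D.replaceRing E).rings + 1 = (D.union E).rings := by
    change D.rings - 1 + E.rings + 1 = D.rings + E.rings
    omega
  rw [← count_union, count, count, add_assoc, rings_eq]
  rfl

theorem count_add_one_of_mem_lineFun_iff {M : PrismDiagram} {h : D.HalfEdge} {a : E.HalfEdge}
    (hr : M.rings = D.rings + E.rings) (e : M.HalfEdge ≃ (D.union E).HalfEdge)
    (hM : ∀ g : (D.union E).HalfEdge → ZMod 2, g ∘ e ∈ M.lineFun C ↔
      g ∈ (D.union E).lineFun C ∧ g (left E h) = g (right D a)) :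
    M.count C + 1 = D.count C + E.count C := by
  let value (x : (D.union E).HalfEdge) : Dual (ZMod 2) ((D.union E).HalfEdge → ZMod 2) :=
    LinearMap.proj x
  let φ := value (left E h) - value (right D a)
  have mem_union : (fun x => Sum.elim (fun _ => 1) (fun _ => 0) x.1) ∈ (D.union E).lineFun C :=
    mem_lineFun_union.2 ⟨mem_lineFun.2 ⟨fun _ => rfl, fun _ _ _ _ => rfl⟩,
      mem_lineFun.2 ⟨fun _ => rfl, fun _ _ _ _ => rfl⟩⟩
  have ker_add_one := finrank_inf_ker_add_one _ mem_union (φ := φ) (sub_ne_zero.2 one_ne_zero)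
  have mem_iff g : g ∘ e ∈ M.lineFun C ↔ g ∈ (D.union E).lineFun C ⊓ LinearMap.ker φ :=
    (hM g).trans (and_congr_right' sub_eq_zero.symm)
  have rings_union : (D.union E).rings = D.rings + E.rings := rfl
  rw [← count_union, count, count, ← ker_add_one, hr, rings_union,
    finrank_eq_of_comp_equiv e mem_iff]
  exact add_right_comm _ _ 1

theorem mem_lineFun_rewire {π : Equiv.Perm D.HalfEdge} {g : D.HalfEdge → ZMod 2} :
    g ∈ (D.rewire π).lineFun C ↔ (∀ x, g (π (D.contr x)) = g (π x)) ∧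
      ∀ c ∈ C, ∀ v i, g (v, prismPartner c i) = g (v, i) := by
  refine mem_lineFun.trans (and_congr_left fun _ => π.symm.forall_congr_left.trans ?_)
  simp [rewire]

theorem comp_symm_mem_lineFun_rewire {π : Equiv.Perm D.HalfEdge} {g : D.HalfEdge → ZMod 2} :
    g ∘ π.symm ∈ (D.rewire π).lineFun C ↔ (∀ x, g (D.contr x) = g x) ∧
      ∀ c ∈ C, ∀ v i, g (π.symm (v, prismPartner c i)) = g (π.symm (v, i)) :=
  mem_lineFun_rewire.trans (by simp)

theorem eq_contr_of_eq_partner {c : PrismColour} {h : D.HalfEdge} {g : D.HalfEdge → ZMod 2}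
    (hg : ∀ v i, g (v, prismPartner c i) = g (v, i))
    (hin : ∀ x, x ≠ h → x ≠ D.contr h → g (D.contr x) = g x) : g (D.contr h) = g h := by
  classical
  have := Fintype.ofFinite D.HalfEdge
  have sum_eq_zero : ∑ x, g x = 0 :=
    sum_eq_zero_of_involution (σ := fun x => (x.1, prismPartner c x.2))
      (fun x => Prod.ext rfl (prismPartner_prismPartner c x.2))
      (fun x hx => prismPartner_ne c x.2 (congrArg Prod.snd hx)) (fun _ _ => Finset.mem_univ _)
      fun x _ => hg x.1 x.2
  have sum_compl_eq_zero : ∑ x ∈ {h, D.contr h}ᶜ, g x = 0 := by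
    refine sum_eq_zero_of_involution D.contr_contr D.contr_ne (fun x hx => ?_) fun x hx => ?_
    all_goals
      obtain ⟨hx, hx'⟩ : x ≠ h ∧ x ≠ D.contr h := by simpa using hx
    · have contr_ne : D.contr x ≠ h := fun hh => hx' (by rw [← hh, D.contr_contr])
      have contr_ne' : D.contr x ≠ D.contr h := fun hh => hx (by
        rw [← D.contr_contr x, hh, D.contr_contr])
      simp [contr_ne, contr_ne']
    · exact hin x hx hx'
  rw [← Finset.sum_add_sum_compl {h, D.contr h}, sum_compl_eq_zero, add_zero,
    Finset.sum_pair (D.contr_ne h).symm] at sum_eq_zero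
  exact (CharTwo.add_eq_zero.1 sum_eq_zero).symm

theorem mem_lineFun_replaceEdge (hC : C.Nonempty) {h : D.HalfEdge} {a : E.HalfEdge}
    {g : (D.union E).HalfEdge → ZMod 2} : g ∈ (D.replaceEdge E h a).lineFun C ↔
      g ∈ (D.union E).lineFun C ∧ g (left E h) = g (right D a) := by
  classical
  let π := Equiv.swap (left E (D.contr h)) (right D a)
  have apply_swap (hg : g (left E (D.contr h)) = g (right D a)) x : g (π x) = g x :=
    Equiv.apply_swap_eq_self hg x
  have fixed {x : D.HalfEdge} (hx : x ≠ D.contr h) : π (left E x) = left E x :=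
    Equiv.swap_apply_of_ne_of_ne (left_injective.ne hx) (left_ne_right x a)
  refine (mem_lineFun_rewire (π := π)).trans ⟨fun ⟨hg, hg'⟩ => ?_, fun ⟨hg, hg'⟩ => ?_⟩
  · have at_cut : g (right D a) = g (left E h) := by
      simpa only [union_contr_left, fixed (D.contr_ne h).symm, π, Equiv.swap_apply_left]
        using hg (left E h)
    obtain ⟨c, hc⟩ := hC
    have across : g (left E (D.contr h)) = g (left E h) :=
      eq_contr_of_eq_partner (g := g ∘ left E) (fun v i => hg' c hc (Sum.inl v) i)
        fun x hx hx' => by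
          simpa only [union_contr_left, fixed hx', fixed (D.contr_injective.ne hx),
            Function.comp_apply] using hg (left E x)
    have hg_swap := apply_swap (across.trans at_cut.symm)
    exact ⟨mem_lineFun.2 ⟨fun x => by rw [← hg_swap, hg, hg_swap], hg'⟩, at_cut.symm⟩
  · rw [mem_lineFun] at hg
    have hg_swap := apply_swap ((hg.1 (left E h)).trans hg')
    exact ⟨fun x => by rw [hg_swap, hg_swap, hg.1], hg.2⟩

theorem count_replaceEdge (hC : C.Nonempty) (h : D.HalfEdge) (a : E.HalfEdge) :
    (D.replaceEdge E h a).count C + 1 = D.count C + E.count C :=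
  count_add_one_of_mem_lineFun_iff rfl (Equiv.refl _) fun _ => mem_lineFun_replaceEdge hC

theorem apply_prismPartner_eq_iff {W : Type*} {α : Type*} {g : W × PrismField → α}
    {c : PrismColour} : (∀ w i, g (w, prismPartner c i) = g (w, i)) ↔
      (∀ w s d, d ≠ c → g (w, s, -(d + c)) = g (w, s, d)) ∧
        ∀ w, g (w, true, c) = g (w, false, c) := by
  constructor
  · refine fun h => ⟨fun w s d hd => ?_, fun w => ?_⟩
    · simpa [prismPartner, hd] using h w (s, d)
    · simpa [prismPartner] using h w (false, c)
  · rintro ⟨h, h'⟩ w ⟨s, d⟩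
    by_cases hd : d = c
    · subst hd
      cases s <;> simp [prismPartner, h']
    · simpa [prismPartner, hd] using h w s d hd

section Expand

variable {v : D.V} {g : (D.V ⊕ Unit) × PrismField → ZMod 2} {c : PrismColour}

theorem triangles_comp_exchange :
    (∀ w s d, d ≠ c → g (D.exchange v (w, s, -(d + c))) = g (D.exchange v (w, s, d))) ↔
      ∀ w s d, d ≠ c → g (w, s, -(d + c)) = g (w, s, d) := by
  suffices exchanged : ∀ k : (D.V ⊕ Unit) × PrismField → ZMod 2,
      (∀ w s d, d ≠ c → k (w, s, -(d + c)) = k (w, s, d)) →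
        ∀ w s d, d ≠ c → k (D.exchange v (w, s, -(d + c))) = k (D.exchange v (w, s, d)) by
    refine ⟨fun hg => ?_, exchanged g⟩
    simpa only [D.exchange_involutive v _] using exchanged (fun x => g (D.exchange v x)) hg
  rintro k hk (w | _) (_ | _) d hd
  · by_cases hw : w = v
    · simpa only [exchange, if_pos hw] using hk _ _ d hd
    · simpa only [exchange, if_neg hw] using hk _ _ d hd
  all_goals exact hk _ _ d hd

theorem rungs_comp_exchange
    (snail : g (.inr (), true, c) = g (.inr (), false, c)) :
    (∀ w, g (D.exchange v (w, true, c)) = g (D.exchange v (w, false, c))) ↔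
      (∀ w, g (w, true, c) = g (w, false, c)) ∧
        g (.inl v, false, c) = g (.inr (), false, c) := by
  constructor
  · intro h
    have at_right : g (.inl v, false, c) = g (.inr (), false, c) := h (.inr ())
    refine ⟨?_, at_right⟩
    rintro (w | _)
    · have at_left := h (.inl w)
      by_cases hw : w = v
      · simp only [exchange, if_pos hw] at at_left
        exact at_left.trans (snail.trans (at_right.symm.trans (by rw [hw])))
      · simpa only [exchange, if_neg hw] using at_left
    · exact snail
  · rintro ⟨h, at_right⟩ (w | _)
    · by_cases hw : w = v
      · simp only [exchange, if_pos hw]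
        exact (h _).trans (Eq.trans (by rw [hw]) (at_right.trans snail.symm))
      · simpa only [exchange, if_neg hw] using h _
    · exact at_right

theorem edges_comp_exchange
    (snail : g (.inr (), true, c) = g (.inr (), false, c)) :
    (∀ w i, g (D.exchange v (w, prismPartner c i)) = g (D.exchange v (w, i))) ↔
      (∀ w i, g (w, prismPartner c i) = g (w, i)) ∧
        g (.inl v, false, c) = g (.inr (), false, c) := by
  rw [apply_prismPartner_eq_iff (g := fun x => g (D.exchange v x)),
    apply_prismPartner_eq_iff (g := g), triangles_comp_exchange, rungs_comp_exchange snail,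
    and_assoc]

theorem mem_lineFun_expand (hc : c ∈ C) {g : (D.union closedSnail).HalfEdge → ZMod 2} :
    g ∘ (D.exchange_involutive v).toPerm.symm ∈ (D.expand v).lineFun C ↔
      g ∈ (D.union closedSnail).lineFun C ∧
        g (left closedSnail (v, false, c)) = g (right D ((), false, c)) := by
  rw [mem_lineFun, and_assoc]
  refine comp_symm_mem_lineFun_rewire.trans ?_
  refine and_congr_right fun hg =>
    (forall₂_congr fun d _ => edges_comp_exchange (hg (right D ((), false, d)))).trans ?_
  refine ⟨fun h => ⟨fun d hd => (h d hd).1, (h c hc).2⟩, fun ⟨h, hvc⟩ d hd => ⟨h d hd, ?_⟩⟩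
  have corner w : g (w, false, d) = g (w, false, c) := by
    rw [← prismPartner_corner c d false, h c hc, h d hd]
  exact (corner _).trans (hvc.trans (corner _).symm)

theorem count_expand (hC : C.Nonempty) (v : D.V) :
    (D.expand v).count C + 1 = D.count C + closedSnail.count C :=
  have ⟨_, hc⟩ := hC
  count_add_one_of_mem_lineFun_iff rfl (D.exchange_involutive v).toPerm.symm
    fun _ => mem_lineFun_expand hc

end Expand

/-- The tetrahedral diagram obtained by splitting each prism vertex into its two triangles: these
become tetrahedral vertices whose fourth fields, `none`, are contracted with each other, so that
the rungs of the prism turn into lines through an auxiliary propagator. -/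
def toTetra (D : PrismDiagram) : TetraDiagram (D.V × Bool) where
  contr
    | ((v, s), none) => ((v, !s), none)
    | ((v, s), some c) =>
      (((D.contr (v, (s, c))).1, (D.contr (v, (s, c))).2.1), some (D.contr (v, (s, c))).2.2)
  contr_contr := by
    rintro ⟨⟨v, s⟩, _ | c⟩
    · simp
    · simp [D.contr_contr]
  contr_ne := by
    rintro ⟨⟨v, s⟩, _ | c⟩ h
    · simp at h
    · simp only [Prod.mk.injEq, Option.some.injEq] at h
      exact D.contr_ne (v, (s, c)) (Prod.ext h.1.1 (Prod.ext h.1.2 h.2))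

theorem mem_loopFun_toTetra {c : PrismColour} {h : (D.V × Bool) × TetraField → ZMod 2} :
    h ∈ D.toTetra.loopFun c Set.univ ↔ (∀ x, h (D.toTetra.contr x) = h x) ∧
      ∀ t i, h (t, tetraPartner c i) = h (t, i) := by
  rw [TetraDiagram.mem_loopFun, TetraDiagram.mem_edgeFun, and_assoc]
  exact ⟨fun hh => ⟨hh.1, fun t i => hh.2.2 (t, i)⟩,
    fun hh => ⟨hh.1, fun x hx => (hx trivial).elim, fun x => hh.2 x.1 x.2⟩⟩

theorem loopRank_toTetra (D : PrismDiagram) (c : PrismColour) :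
    D.toTetra.loopRank c Set.univ = finrank (ZMod 2) (D.lineFun {c}) := by
  let φ : D.toTetra.loopFun c Set.univ ≃ₗ[ZMod 2] D.lineFun {c} :=
    { toFun := fun h => ⟨fun x => h.1 ((x.1, x.2.1), some x.2.2), by
        obtain ⟨h_contr, h_partner⟩ := mem_loopFun_toTetra.1 h.2
        refine mem_lineFun.2 ⟨fun x => h_contr ((x.1, x.2.1), some x.2.2), ?_⟩
        rintro _ rfl
        refine apply_prismPartner_eq_iff (g := fun x : D.HalfEdge => h.1 ((x.1, x.2.1), some x.2.2))
          |>.2 ⟨fun v s d hd => ?_, fun v => ?_⟩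
        · simpa only [tetraPartner, if_neg hd] using h_partner (v, s) (some d)
        · exact (h_partner (v, true) none).trans
            ((h_contr ((v, false), none)).trans (h_partner (v, false) none).symm)⟩
      map_add' := fun _ _ => rfl
      map_smul' := fun _ _ => rfl
      invFun := fun g => ⟨fun x => g.1 (x.1.1, (x.1.2, x.2.getD c)), by
        obtain ⟨g_contr, g_partner⟩ := mem_lineFun.1 g.2
        replace g_partner := g_partner c rfl
        refine mem_loopFun_toTetra.2 ⟨?_, ?_⟩
        · rintro ⟨⟨v, s⟩, _ | d⟩
          · exact (congrArg (fun i => g.1 (v, i)) (prismPartner_rung c s)).symm.trans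
              (g_partner v (s, c))
          · exact g_contr (v, (s, d))
        · rintro ⟨v, s⟩ (_ | d)
          · rfl
          · by_cases hd : d = c
            · simp [tetraPartner, hd]
            · simpa [prismPartner, tetraPartner, hd] using g_partner v (s, d)⟩
      left_inv := fun h => Subtype.ext (funext fun x => by
        obtain ⟨t, _ | d⟩ := x
        · exact (mem_loopFun_toTetra.1 h.2).2 t none
        · rfl)
      right_inv := fun _ => rfl }
  exact φ.finrank_eq

theorem one_mem_lineFun (D : PrismDiagram) (C : Set PrismColour) :
    (fun _ => 1 : D.HalfEdge → ZMod 2) ∈ D.lineFun C :=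
  mem_lineFun.2 ⟨fun _ => rfl, fun _ _ _ _ => rfl⟩

namespace Connected

variable [Nonempty D.V] (hD : D.Connected)
include hD

theorem rings_eq_zero_and_finrank_eq_one :
    D.rings = 0 ∧ finrank (ZMod 2) (D.lineFun Set.univ) = 1 := by
  rw [connected_iff_count_eq_one, count] at hD
  obtain ⟨v⟩ := ‹Nonempty D.V›
  have : Nontrivial (D.lineFun Set.univ) :=
    ⟨⟨⟨_, D.one_mem_lineFun _⟩, 0,
      fun h => one_ne_zero (congrFun (congrArg Subtype.val h) (v, (false, 0)))⟩⟩
  have : 0 < finrank (ZMod 2) (D.lineFun Set.univ) := finrank_pos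
  lia

theorem apply_eq_of_mem_lineFun_univ {g : D.HalfEdge → ZMod 2} (hg : g ∈ D.lineFun Set.univ)
    (x y : D.HalfEdge) : g x = g y := by
  let one : D.lineFun Set.univ := ⟨_, D.one_mem_lineFun _⟩
  have one_ne_zero : one ≠ 0 :=
    fun h => _root_.one_ne_zero (congrFun (congrArg Subtype.val h) x)
  obtain ⟨a, ha⟩ := (finrank_eq_one_iff_of_nonzero' one one_ne_zero).1
    hD.rings_eq_zero_and_finrank_eq_one.2 ⟨g, hg⟩
  have g_eq z : a * 1 = g z := congrFun (congrArg Subtype.val ha) z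
  rw [← g_eq, ← g_eq]

theorem isConnected_toTetra : D.toTetra.IsConnected := by
  intro g hg
  have hg x : g (D.toTetra.contr x).1 = g x.1 := hg x ⟨trivial, trivial⟩
  have triangle_eq v s : g (v, s) = g (v, false) := by
    cases s
    · rfl
    · exact hg ((v, false), none)
  have mem_lineFun_univ : (fun x => g (x.1, false)) ∈ D.lineFun Set.univ :=
    mem_lineFun.2 ⟨fun x => (triangle_eq _ _).symm.trans
      ((hg ((x.1, x.2.1), some x.2.2)).trans (triangle_eq _ _)), fun _ _ _ _ => rfl⟩
  rintro ⟨v, s⟩ - ⟨w, t⟩ -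
  rw [triangle_eq, triangle_eq w]
  exact hD.apply_eq_of_mem_lineFun_univ mem_lineFun_univ (v, (false, 0)) (w, (false, 0))

theorem sum_loopRank_toTetra : ∑ c, D.toTetra.loopRank c Set.univ = D.totalLoops := by
  simp only [totalLoops_eq_sum_count, count, hD.rings_eq_zero_and_finrank_eq_one.1, add_zero,
    loopRank_toTetra]

end Connected

theorem natCard_prod_bool (D : PrismDiagram) : Nat.card (D.V × Bool) = 2 * D.numVertices := by
  rw [Nat.card_prod, Nat.card_eq_fintype_card (α := Bool), Fintype.card_bool, mul_comm, numVertices]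

theorem count_eq_rings [IsEmpty D.V] (C : Set PrismColour) : D.count C = D.rings := by
  rw [count, finrank_zero_of_subsingleton, zero_add]

theorem Connected.totalLoops_le (hD : D.Connected) : D.totalLoops ≤ 3 + 3 * D.numVertices := by
  rcases isEmpty_or_nonempty D.V with hV | hV
  · rw [connected_iff_count_eq_one, count_eq_rings] at hD
    simp only [totalLoops_eq_sum_count, count_eq_rings, hD, Fin.sum_univ_three]
    lia
  · have hG := hD.isConnected_toTetra
    have h01 := hG.loopRank_add_loopRank_le (show (0 : Fin 3) ≠ 1 by decide)
    have h02 := hG.loopRank_add_loopRank_le (show (0 : Fin 3) ≠ 2 by decide)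
    have h12 := hG.loopRank_add_loopRank_le (show (1 : Fin 3) ≠ 2 by decide)
    rw [natCard_prod_bool] at h01 h02 h12
    rw [← hD.sum_loopRank_toTetra, Fin.sum_univ_three]
    lia

theorem toTetra_contr_some {v w : D.V} {s t : Bool} {c d : PrismColour} :
    D.toTetra.contr ((v, s), some c) = ((w, t), some d) ↔ D.contr (v, (s, c)) = (w, (t, d)) := by
  simp [toTetra, Prod.ext_iff, and_assoc]

theorem toTetra_contr_snd_eq_none_iff (x : (D.V × Bool) × TetraField) :
    (D.toTetra.contr x).2 = none ↔ x.2 = none := by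
  obtain ⟨⟨v, s⟩, _ | c⟩ := x <;> simp [toTetra]

theorem exists_contr_eq_of_hasMelon (h : D.toTetra.HasMelon) :
    ∃ t u k, ∀ l ≠ k, D.toTetra.contr (t, l) = (u, l) := by
  obtain ⟨⟨t, i⟩, m, hm⟩ := h
  obtain ⟨⟨u, j⟩, hj⟩ : ∃ y, D.toTetra.contr (t, i) = y := ⟨_, rfl⟩
  have contr_eq c (hc : c ≠ m) : D.toTetra.contr (t, tetraPartner c i) = (u, tetraPartner c j) := by
    simpa only [TetraDiagram.partner, hj] using (hm c hc).2
  have none_iff {k l} (h : D.toTetra.contr (t, k) = (u, l)) : l = none ↔ k = none := by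
    simpa only [h] using D.toTetra_contr_snd_eq_none_iff (t, k)
  obtain rfl : i = j := by
    have none_iff_partner c hc := none_iff (contr_eq c hc)
    have none_iff_self := none_iff hj
    clear * - none_iff_partner none_iff_self
    revert i j m
    decide
  refine ⟨t, u, tetraPartner m i, fun l hl => ?_⟩
  obtain rfl | ⟨c, hc, rfl⟩ : l = i ∨ ∃ c, c ≠ m ∧ l = tetraPartner c i := by
    clear * - hl
    revert i l m
    decide
  exacts [hj, contr_eq c hc]

/-- The rungs of `v` with colours in `C` have their two ends contracted with each other. For
`C = {d}ᶜ` an elementary snail is inserted at `v`, with its external fields at the rung `d`; for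
`C = Set.univ` the vertex is a copy of `closedSnail`. -/
def ContractsRungs (D : PrismDiagram) (v : D.V) (C : Set PrismColour) : Prop :=
  ∀ c ∈ C, D.contr (v, (false, c)) = (v, (true, c))

theorem ContractsRungs.contr_eq {v : D.V} (h : D.ContractsRungs v C) {c : PrismColour}
    (hc : c ∈ C) (s : Bool) : D.contr (v, (s, c)) = (v, (!s, c)) := by
  cases s
  · exact h c hc
  · rw [← h c hc, D.contr_contr]
    rfl

/-- The triangle `s` of `v` and the triangle `t` of another vertex `w` are contracted with each
other corner by corner, as they are after the expansion of a vertex. -/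
def ContractsTriangles (D : PrismDiagram) (v w : D.V) (s t : Bool) : Prop :=
  v ≠ w ∧ ∀ c, D.contr (v, (s, c)) = (w, (t, c))

theorem exists_contractsRungs_or_contractsTriangles (h : D.toTetra.HasMelon) :
    (∃ v d, D.ContractsRungs v {d}ᶜ) ∨ ∃ v w s t, D.ContractsTriangles v w s t := by
  obtain ⟨⟨v, s⟩, ⟨w, t⟩, k, hk⟩ := exists_contr_eq_of_hasMelon h
  have contr_eq c (hc : some c ≠ k) : D.contr (v, (s, c)) = (w, (t, c)) :=
    toTetra_contr_some.1 (hk _ hc)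
  by_cases hvw : v = w
  · subst hvw
    have not_eq_none {c : PrismColour} (hc : c ≠ k.getD 0) : some c ≠ k := by
      rintro rfl
      exact hc rfl
    obtain ⟨c, hc⟩ := exists_ne (k.getD 0)
    obtain rfl : t = !s := by
      refine (Bool.eq_or_eq_not t s).resolve_left ?_
      rintro rfl
      exact D.contr_ne _ (contr_eq c (not_eq_none hc))
    refine .inl ⟨v, k.getD 0, fun e he => ?_⟩
    have contr_rung := contr_eq e (not_eq_none he)
    cases s
    · exact contr_rung
    · rw [← D.contr_contr (v, (true, e)), contr_rung]
      rfl
  · obtain rfl : k = none := by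
      by_contra hk'
      exact hvw (congrArg (fun x => x.1.1) (hk none (Ne.symm hk')))
    exact .inr ⟨v, w, s, t, hvw, fun c => contr_eq c (by simp)⟩

/-- The diagram `M` arises from `D` by a move that inserts `E`: the vertices add up, and each graph
of propagators and edges of the colours in `C ≠ ∅` is the union of those of `D` and `E` with one
component of the one joined to one component of the other. -/
structure IsInsertion (D E M : PrismDiagram) : Prop where
  numVertices_eq : M.numVertices = D.numVertices + E.numVertices
  count_add_one : ∀ C : Set PrismColour, C.Nonempty → M.count C + 1 = D.count C + E.count C

theorem isInsertion_replaceEdge (h : D.HalfEdge) (a : E.HalfEdge) :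
    IsInsertion D E (D.replaceEdge E h a) :=
  ⟨numVertices_union D E, fun _ hC => count_replaceEdge hC h a⟩

theorem isInsertion_replaceRing (E : PrismDiagram) (hD : 0 < D.rings) :
    IsInsertion D E (D.replaceRing E) :=
  ⟨numVertices_union D E, fun C _ => count_replaceRing E hD C⟩

theorem isInsertion_expand (v : D.V) : IsInsertion D closedSnail (D.expand v) :=
  ⟨numVertices_union D closedSnail, fun _ hC => count_expand hC v⟩

/-- A connected diagram that attains the upper bound `Connected.totalLoops_le` on the number of
index loops. -/
def IsExtremal (D : PrismDiagram) : Prop :=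
  D.Connected ∧ D.totalLoops = 3 + 3 * D.numVertices

theorem IsInsertion.isExtremal_iff {M : PrismDiagram} (h : IsInsertion D E M)
    (hE : E.IsExtremal) : M.IsExtremal ↔ D.IsExtremal := by
  obtain ⟨connected_E, loops_E⟩ := hE
  have vertices := h.numVertices_eq
  have components := h.count_add_one Set.univ Set.univ_nonempty
  have loops c := h.count_add_one {c} (Set.singleton_nonempty c)
  have loops_0 := loops 0
  have loops_1 := loops 1
  have loops_2 := loops 2
  simp only [IsExtremal, connected_iff_count_eq_one, totalLoops_eq_sum_count,
    Fin.sum_univ_three] at *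
  lia

theorem Iso.isExtremal_iff (h : Iso D D') : D.IsExtremal ↔ D'.IsExtremal := by
  simp only [IsExtremal, connected_iff_count_eq_one, totalLoops_eq_sum_count, h.count_eq,
    h.numVertices_eq]

theorem isExtremal_zeroCycle : zeroCycle.IsExtremal := by
  have : IsEmpty zeroCycle.V := inferInstanceAs (IsEmpty Empty)
  have no_vertex : zeroCycle.numVertices = 0 := Nat.card_of_isEmpty
  have one_ring : zeroCycle.rings = 1 := rfl
  simp [IsExtremal, connected_iff_count_eq_one, totalLoops_eq_sum_count, count_eq_rings,
    no_vertex, one_ring]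

theorem numVertices_closedSnail : closedSnail.numVertices = 1 := Nat.card_unique (α := Unit)

theorem prismPartner_snd_eq_iff {c : PrismColour} (i : PrismField) :
    (prismPartner c i).2 = c ↔ i.2 = c := by
  revert c i; decide

theorem two_le_loops_closedSnail (c : PrismColour) : 2 ≤ closedSnail.loops c := by
  let isRung : Quot (closedSnail.Strand c) → Bool := Quot.lift (fun x => decide (x.2.2 = c)) (by
    rintro x _ (rfl | rfl)
    · rfl
    · exact decide_eq_decide.2 (prismPartner_snd_eq_iff x.2).symm)
  have isRung_surjective : Function.Surjective isRung := by
    rintro (_ | _)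
    · exact ⟨Quot.mk _ ((), (false, c + 1)), by simp [isRung]⟩
    · exact ⟨Quot.mk _ ((), (false, c)), by simp [isRung]⟩
  have card_le := Nat.card_le_card_of_surjective isRung isRung_surjective
  rw [Nat.card_eq_fintype_card, Fintype.card_bool] at card_le
  exact card_le

theorem isExtremal_closedSnail : closedSnail.IsExtremal := by
  have : Subsingleton (Quot closedSnail.Adj) := Quot.Subsingleton (α := Unit)
  have connected : closedSnail.Connected := Nat.card_of_subsingleton (Quot.mk closedSnail.Adj ())
  refine ⟨connected, le_antisymm connected.totalLoops_le ?_⟩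
  rw [numVertices_closedSnail, totalLoops, Fin.sum_univ_three]
  have loops_0 := two_le_loops_closedSnail 0
  have loops_1 := two_le_loops_closedSnail 1
  have loops_2 := two_le_loops_closedSnail 2
  lia

theorem expand_closedSnail_iso_closedMelon : Iso (closedSnail.expand ()) closedMelon := by
  refine ⟨rfl, Equiv.boolEquivPUnitSumPUnit.symm.prodCongr (Equiv.refl PrismField), ?_,
    fun _ _ => rfl⟩
  have exchange_false c : closedSnail.exchange () (.inl (), (false, c)) = (.inr (), (true, c)) :=
    if_pos rfl
  let e := Equiv.boolEquivPUnitSumPUnit.symm.prodCongr (Equiv.refl PrismField)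
  let contr := (closedSnail.union closedSnail).contr
  rintro ⟨_ | _, _ | _, c⟩
  · exact congrArg (fun x => e (closedSnail.exchange () (contr x))) (exchange_false c)
  · exact congrArg e (exchange_false c)
  · rfl
  · rfl

theorem isExtremal_closedMelon : closedMelon.IsExtremal :=
  expand_closedSnail_iso_closedMelon.isExtremal_iff.1
    ((isInsertion_expand _).isExtremal_iff isExtremal_closedSnail |>.2 isExtremal_closedSnail)

theorem exists_isExtremal_of_numVertices (n : ℕ) :
    ∃ D : PrismDiagram, D.IsExtremal ∧ D.numVertices = n := by
  induction n with
  | zero => exact ⟨zeroCycle, isExtremal_zeroCycle, Nat.card_of_isEmpty (α := Empty)⟩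
  | succ n ih =>
    obtain ⟨D, hD, rfl⟩ := ih
    rcases isEmpty_or_nonempty D.V with hV | ⟨⟨v⟩⟩
    · refine ⟨closedSnail, isExtremal_closedSnail, ?_⟩
      rw [numVertices_closedSnail, numVertices, Nat.card_of_isEmpty]
    · have insertion := isInsertion_expand v
      refine ⟨D.expand v, (insertion.isExtremal_iff isExtremal_closedSnail).2 hD, ?_⟩
      rw [insertion.numVertices_eq, numVertices_closedSnail]

theorem isMaximal_iff_isExtremal : D.IsMaximal ↔ D.IsExtremal := by
  refine and_congr_right fun hD => ⟨fun maximal => ?_, fun loops_D D' hD' vertices => ?_⟩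
  · obtain ⟨E, ⟨hE, loops_E⟩, vertices⟩ := exists_isExtremal_of_numVertices D.numVertices
    refine le_antisymm hD.totalLoops_le ?_
    rw [← vertices, ← loops_E]
    exact maximal E hE vertices
  · rw [loops_D, ← vertices]
    exact hD'.totalLoops_le

theorem iso_rewire (π : Equiv.Perm D.HalfEdge)
    (hπ : ∀ c x, π (x.1, prismPartner c x.2) = ((π x).1, prismPartner c (π x).2)) :
    Iso D (D.rewire π) := by
  refine ⟨rfl, π, fun x => ?_, hπ⟩
  change π (D.contr x) = π (D.contr (π.symm (π x)))
  rw [Equiv.symm_apply_apply]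

theorem rewire_rewire_symm_iso (π : Equiv.Perm D.HalfEdge) :
    Iso ((D.rewire π).rewire π.symm) D := by
  refine ⟨rfl, Equiv.refl _, fun (x : D.HalfEdge) => ?_, fun _ _ => rfl⟩
  change π.symm (π (D.contr (π.symm (π x)))) = D.contr x
  rw [Equiv.symm_apply_apply, Equiv.symm_apply_apply]

theorem rewire_iso_rewire (hr : D.rings = D'.rings) (e : D.HalfEdge ≃ D'.HalfEdge)
    (he : ∀ x, e (D.contr x) = D'.contr (e x))
    (hp : ∀ c x, e (x.1, prismPartner c x.2) = ((e x).1, prismPartner c (e x).2))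
    {π : Equiv.Perm D.HalfEdge} {π' : Equiv.Perm D'.HalfEdge} (hπ : ∀ x, e (π x) = π' (e x)) :
    Iso (D.rewire π) (D'.rewire π') := by
  refine ⟨hr, e, fun (x : D.HalfEdge) => ?_, hp⟩
  have symm_apply : e (π.symm x) = π'.symm (e x) := by
    rw [Equiv.eq_symm_apply, ← hπ, Equiv.apply_symm_apply]
  change e (π (D.contr (π.symm x))) = π' (D'.contr (π'.symm (e x)))
  rw [hπ, he, symm_apply]

/-- The diagram `D` without a vertex `v` that is a copy of `closedSnail`. -/
def remove (D : PrismDiagram) (v : D.V) (hv : D.ContractsRungs v Set.univ) : PrismDiagram where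
  V := {w : D.V // w ≠ v}
  finite := inferInstance
  contr x := (⟨(D.contr (x.1.1, x.2)).1, fun h => x.1.2 (by
    have contr_eq : D.contr (x.1.1, x.2) = (v, (D.contr (x.1.1, x.2)).2) := Prod.ext h rfl
    have fst_eq := congrArg Prod.fst (D.contr_contr (x.1.1, x.2))
    rw [contr_eq, hv.contr_eq trivial] at fst_eq
    exact fst_eq.symm)⟩, (D.contr (x.1.1, x.2)).2)
  contr_contr x := by simp [D.contr_contr]
  contr_ne x h := D.contr_ne (x.1.1, x.2)
    (Prod.ext (congrArg (fun y => y.1.1) h) (congrArg (fun y => y.2) h))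
  rings := D.rings

open Classical in
/-- The permutation of the fields that exchanges the triangles `x` and `y` corner by corner. -/
noncomputable def triangleSwap {V : Type*} (x y : V × Bool) : Equiv.Perm (V × PrismField) :=
  (Equiv.prodAssoc V Bool PrismColour).permCongr
    ((Equiv.swap x y).prodCongr (Equiv.refl PrismColour))

theorem triangleSwap_apply_left {V : Type*} (x y : V × Bool) (c : PrismColour) :
    triangleSwap x y (x.1, (x.2, c)) = (y.1, (y.2, c)) := by
  simp [triangleSwap]

theorem triangleSwap_apply_right {V : Type*} (x y : V × Bool) (c : PrismColour) :
    triangleSwap x y (y.1, (y.2, c)) = (x.1, (x.2, c)) := by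
  simp [triangleSwap]

open Classical in
theorem triangleSwap_apply_of_ne {V : Type*} {x y z : V × Bool} (hx : z ≠ x) (hy : z ≠ y)
    (c : PrismColour) : triangleSwap x y (z.1, (z.2, c)) = (z.1, (z.2, c)) := by
  simp [triangleSwap, Equiv.swap_apply_of_ne_of_ne hx hy]

section Remove

variable {v : D.V} (hv : D.ContractsRungs v Set.univ)

open Classical in
/-- The fields of `D` are those of `v` and those of the other vertices. -/
noncomputable def removeEquiv : ((D.remove v hv).union closedSnail).HalfEdge ≃ D.HalfEdge :=
  ((Equiv.optionEquivSumPUnit {w : D.V // w ≠ v}).symm.trans (Equiv.optionSubtypeNe v)).prodCongr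
    (Equiv.refl PrismField)

theorem removeEquiv_contr (x : ((D.remove v hv).union closedSnail).HalfEdge) :
    removeEquiv hv (((D.remove v hv).union closedSnail).contr x) =
      D.contr (removeEquiv hv x) := by
  obtain ⟨w | _, s, c⟩ := x
  · rfl
  · exact (hv.contr_eq trivial s).symm

theorem union_remove_closedSnail_iso : Iso ((D.remove v hv).union closedSnail) D :=
  ⟨rfl, removeEquiv hv, removeEquiv_contr hv, fun _ _ => rfl⟩

theorem rewire_remove_iso {π : Equiv.Perm ((D.remove v hv).union closedSnail).HalfEdge}
    {π' : Equiv.Perm D.HalfEdge} (hπ : ∀ x, removeEquiv hv (π x) = π' (removeEquiv hv x)) :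
    Iso (((D.remove v hv).union closedSnail).rewire π) (D.rewire π') :=
  rewire_iso_rewire (D := (D.remove v hv).union closedSnail) (D' := D) rfl (removeEquiv hv)
    (removeEquiv_contr hv) (fun _ _ => rfl) hπ

open Classical in
theorem replaceEdge_remove_iso (y : (D.remove v hv).HalfEdge) (a : closedSnail.HalfEdge) :
    Iso ((D.remove v hv).replaceEdge closedSnail y a)
      (D.rewire (Equiv.swap (D.contr (y.1.1, y.2)) (v, a.2))) :=
  rewire_remove_iso hv fun _ => ((removeEquiv hv).injective.swap_apply _ _ _).symm

theorem expand_remove_iso {w : D.V} (hw : D.ContractsRungs w Set.univ) (hvw : v ≠ w) :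
    Iso ((D.remove w hw).expand ⟨v, hvw⟩) (D.rewire (triangleSwap (v, false) (w, true))) := by
  classical
  refine rewire_remove_iso hw ?_
  rintro ⟨⟨u, hu⟩ | _, _ | _, c⟩
  · by_cases huv : u = v
    · subst huv
      exact (congrArg (removeEquiv hw) (if_pos rfl)).trans
        (triangleSwap_apply_left (u, false) (w, true) c).symm
    · exact (congrArg (removeEquiv hw) (if_neg (huv <| congrArg Subtype.val ·))).trans
        (triangleSwap_apply_of_ne (z := (u, false)) (by simp [huv]) (by simp) c).symm
  · exact (triangleSwap_apply_of_ne (z := (u, true)) (by simp) (by simp [hu]) c).symm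
  · exact (triangleSwap_apply_of_ne (z := (w, false)) (by simp [hvw.symm]) (by simp) c).symm
  · exact (triangleSwap_apply_right (v, false) (w, true) c).symm

end Remove

open Classical in
theorem ContractsRungs.rewire_swap {v : D.V} {d : PrismColour} (h : D.ContractsRungs v {d}ᶜ) :
    (D.rewire (Equiv.swap (D.contr (v, (true, d))) (v, (false, d)))).ContractsRungs v Set.univ := by
  let p : D.HalfEdge := (v, (false, d))
  let q : D.HalfEdge := (v, (true, d))
  have hqp : q ≠ p := by simp [p, q]
  intro c _
  change Equiv.swap (D.contr q) p (D.contr (Equiv.swap (D.contr q) p (v, (false, c)))) =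
    (v, (true, c))
  by_cases hc : c = d
  · subst hc
    rw [Equiv.swap_apply_right, D.contr_contr,
      Equiv.swap_apply_of_ne_of_ne (D.contr_ne q).symm hqp]
  · have fixed s : Equiv.swap (D.contr q) p (v, (s, c)) = (v, (s, c)) := by
      refine Equiv.swap_apply_of_ne_of_ne (fun hs => ?_) (by simp [p, hc])
      have contr_eq := h.contr_eq hc s
      rw [hs, D.contr_contr] at contr_eq
      exact hc (congrArg (fun x => x.2.2) contr_eq).symm
    rw [fixed, h c hc, fixed]

theorem ContractsRungs.fst_contr_ne {v : D.V} {d : PrismColour} (h : D.ContractsRungs v {d}ᶜ)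
    (hd : D.contr (v, (false, d)) ≠ (v, (true, d))) : (D.contr (v, (false, d))).1 ≠ v := by
  intro hv
  obtain ⟨⟨s, c⟩, hc⟩ : ∃ i, D.contr (v, (false, d)) = (v, i) := ⟨_, Prod.ext hv rfl⟩
  by_cases hcd : c = d
  · subst hcd
    cases s
    exacts [D.contr_ne _ hc, hd hc]
  · have contr_eq := h.contr_eq hcd s
    rw [← hc, D.contr_contr] at contr_eq
    exact hcd (congrArg (fun x => x.2.2) contr_eq).symm

theorem ContractsRungs.exists_iso {v : D.V} {d : PrismColour} (h : D.ContractsRungs v {d}ᶜ) :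
    (∃ X : PrismDiagram, Iso (X.union closedSnail) D) ∨
      ∃ (X : PrismDiagram) (y : X.HalfEdge) (a : closedSnail.HalfEdge),
        Iso (X.replaceEdge closedSnail y a) D := by
  classical
  by_cases hd : D.contr (v, (false, d)) = (v, (true, d))
  · have hv : D.ContractsRungs v Set.univ := fun c _ => by
      by_cases hc : c = d
      exacts [hc ▸ hd, h c hc]
    exact .inl ⟨_, union_remove_closedSnail_iso hv⟩
  · let p : D.HalfEdge := (v, (false, d))
    let q : D.HalfEdge := (v, (true, d))
    let π := Equiv.swap (D.contr q) p
    have contr_p_ne : D.contr p ≠ D.contr q := D.contr_injective.ne (by simp [p, q])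
    have rewire_contr : (D.rewire π).contr (D.contr p) = D.contr q := by
      change π (D.contr (π (D.contr p))) = D.contr q
      rw [Equiv.swap_apply_of_ne_of_ne contr_p_ne (D.contr_ne p), D.contr_contr,
        Equiv.swap_apply_right]
    have undo := D.rewire_rewire_symm_iso π
    rw [Equiv.symm_swap, ← rewire_contr] at undo
    exact .inr ⟨(D.rewire π).remove v h.rewire_swap,
      (⟨(D.contr p).1, h.fst_contr_ne hd⟩, (D.contr p).2), ((), (false, d)),
      (replaceEdge_remove_iso h.rewire_swap _ _).trans undo⟩

/-- The permutation of the fields that exchanges the two triangles of each vertex `v` with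
`f v = true`. -/
def flipPerm {V : Type*} (f : V → Bool) : Equiv.Perm (V × PrismField) :=
  Function.Involutive.toPerm (fun x => (x.1, (xor x.2.1 (f x.1), x.2.2))) fun x => by simp

theorem flipPerm_apply {V : Type*} (f : V → Bool) (x : V × PrismField) :
    flipPerm f x = (x.1, (xor x.2.1 (f x.1), x.2.2)) := rfl

theorem iso_rewire_flipPerm (f : D.V → Bool) : Iso D (D.rewire (flipPerm f)) := by
  refine iso_rewire _ ?_
  rintro c ⟨v, s, d⟩
  by_cases hd : d = c <;> simp [flipPerm_apply, prismPartner, hd]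

theorem ContractsTriangles.rewire_flipPerm {v w : D.V} {s t : Bool}
    (h : D.ContractsTriangles v w s t) (f : D.V → Bool) :
    (D.rewire (flipPerm f)).ContractsTriangles v w (xor s (f v)) (xor t (f w)) := by
  refine ⟨h.1, fun c => ?_⟩
  change flipPerm f (D.contr ((flipPerm f).symm (flipPerm f (v, (s, c))))) =
    flipPerm f (w, (t, c))
  rw [Equiv.symm_apply_apply, h.2]

theorem ContractsTriangles.rewire_triangleSwap {v w : D.V}
    (h : D.ContractsTriangles v w false false) :
    (D.rewire (triangleSwap (v, false) (w, true))).ContractsRungs w Set.univ := by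
  intro c _
  let π := triangleSwap (v, false) (w, true)
  have fixed : π (w, (false, c)) = (w, (false, c)) :=
    triangleSwap_apply_of_ne (z := (w, false)) (by simp [h.1.symm]) (by simp) c
  have contr_eq : D.contr (w, (false, c)) = (v, (false, c)) := by rw [← h.2, D.contr_contr]
  change π (D.contr (π.symm (w, (false, c)))) = (w, (true, c))
  rw [(Equiv.symm_apply_eq π).2 fixed.symm, contr_eq]
  exact triangleSwap_apply_left (v, false) (w, true) c

theorem ContractsTriangles.exists_iso_expand_of_false {v w : D.V}
    (h : D.ContractsTriangles v w false false) :
    ∃ (X : PrismDiagram) (u : X.V), Iso (X.expand u) D :=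
  ⟨_, _, (expand_remove_iso h.rewire_triangleSwap h.1).trans
    (rewire_rewire_symm_iso (triangleSwap (v, false) (w, true)))⟩

theorem ContractsTriangles.exists_iso_expand {v w : D.V} {s t : Bool}
    (h : D.ContractsTriangles v w s t) :
    ∃ (X : PrismDiagram) (u : X.V), Iso (X.expand u) D := by
  classical
  let f u := if u = v then s else t
  have flipped := h.rewire_flipPerm f
  have hv : xor s (f v) = false := by simp [f]
  have hw : xor t (f w) = false := by simp [f, h.1.symm]
  rw [hv, hw] at flipped
  obtain ⟨X, u, hX⟩ := flipped.exists_iso_expand_of_false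
  exact ⟨X, u, hX.trans (iso_rewire_flipPerm f).symm⟩

theorem isEmpty_and_rings_eq_zero_of_count_eq_zero (h : D.count C = 0) :
    IsEmpty D.V ∧ D.rings = 0 := by
  obtain ⟨finrank_eq_zero, rings_eq_zero⟩ := Nat.add_eq_zero_iff.1 h
  refine ⟨⟨fun v => ?_⟩, rings_eq_zero⟩
  have one_eq_zero := (finrank_zero_iff.1 finrank_eq_zero).elim ⟨_, D.one_mem_lineFun C⟩ 0
  exact one_ne_zero (congrFun (congrArg Subtype.val one_eq_zero) (v, (false, 0)))

theorem union_iso_replaceRing (X E : PrismDiagram) [IsEmpty X.V] (hX : X.rings = 0) :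
    Iso (X.union E) (zeroCycle.replaceRing E) := by
  refine ⟨congrArg (· + E.rings) hX,
    ((Equiv.equivOfIsEmpty X.V Empty).sumCongr (Equiv.refl _)).prodCongr (Equiv.refl _), ?_,
    fun _ _ => rfl⟩
  rintro ⟨w | w, i⟩
  · exact isEmptyElim w
  · rfl

theorem iso_zeroCycle [IsEmpty D.V] (hD : D.rings = 1) : Iso zeroCycle D := by
  have : IsEmpty zeroCycle.HalfEdge := ⟨fun x => Empty.elim x.1⟩
  exact ⟨hD.symm, Equiv.equivOfIsEmpty _ _, fun x => isEmptyElim x, fun _ x => isEmptyElim x⟩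

theorem IsExtremal.hasMelon_toTetra [Nonempty D.V] (hD : D.IsExtremal) : D.toTetra.HasMelon := by
  obtain ⟨connected, loops⟩ := hD
  refine TetraDiagram.IsTight.hasMelon ?_ connected.isConnected_toTetra ?_
  · rw [TetraDiagram.IsTight, connected.sum_loopRank_toTetra, natCard_prod_bool]
    lia
  · rw [natCard_prod_bool]
    exact even_two_mul _

theorem Connected.replaceRing_iso_of_union_iso {X : PrismDiagram} (hD : D.Connected)
    (hE : E.Connected) (h : Iso (X.union E) D) : Iso (zeroCycle.replaceRing E) D := by
  have count_eq := h.count_eq Set.univ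
  rw [connected_iff_count_eq_one] at hD hE
  rw [count_union, hD, hE] at count_eq
  obtain ⟨_, rings_eq_zero⟩ :=
    isEmpty_and_rings_eq_zero_of_count_eq_zero (Nat.add_eq_right.1 count_eq)
  exact (union_iso_replaceRing X E rings_eq_zero).symm.trans h

theorem IsExtremal.exists_isInsertion_closedSnail [Nonempty D.V] (hD : D.IsExtremal) :
    ∃ X M : PrismDiagram,
      IsInsertion X closedSnail M ∧ (X.Generated → M.Generated) ∧ Iso M D := by
  obtain ⟨v, d, h⟩ | ⟨v, w, s, t, h⟩ :=
    exists_contractsRungs_or_contractsTriangles hD.hasMelon_toTetra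
  · obtain ⟨X, hX⟩ | ⟨X, y, a, hX⟩ := h.exists_iso
    · exact ⟨zeroCycle, _, isInsertion_replaceRing closedSnail Nat.one_pos,
        .snailRing Nat.one_pos, hD.1.replaceRing_iso_of_union_iso isExtremal_closedSnail.1 hX⟩
    · exact ⟨X, _, isInsertion_replaceEdge y a, .snail y a, hX⟩
  · obtain ⟨X, u, hX⟩ := h.exists_iso_expand
    exact ⟨X, _, isInsertion_expand u, .expand u, hX⟩

theorem IsExtremal.generated (hD : D.IsExtremal) : D.Generated := by
  induction hn : D.numVertices generalizing D with
  | zero =>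
    have : IsEmpty D.V := Finite.card_eq_zero_iff.1 hn
    refine .iso .zeroCycle (iso_zeroCycle ?_)
    rw [← count_eq_rings Set.univ]
    exact connected_iff_count_eq_one.1 hD.1
  | succ n ih =>
    have : Nonempty D.V := (Nat.card_pos_iff.1 (hn.trans_gt n.succ_pos)).1
    obtain ⟨X, M, insertion, generated, iso⟩ := hD.exists_isInsertion_closedSnail
    refine .iso (generated (ih ?_ ?_)) iso
    · rwa [← insertion.isExtremal_iff isExtremal_closedSnail, iso.isExtremal_iff]
    · have vertices := insertion.numVertices_eq
      rw [iso.numVertices_eq, hn, numVertices_closedSnail] at vertices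
      exact (Nat.succ_injective vertices).symm

theorem Generated.isExtremal (hD : D.Generated) : D.IsExtremal := by
  induction hD with
  | zeroCycle => exact isExtremal_zeroCycle
  | iso _ h ih => exact h.isExtremal_iff.1 ih
  | snail h a _ ih =>
    exact ((isInsertion_replaceEdge h a).isExtremal_iff isExtremal_closedSnail).2 ih
  | snailRing h _ ih =>
    exact ((isInsertion_replaceRing _ h).isExtremal_iff isExtremal_closedSnail).2 ih
  | melon h a _ ih =>
    exact ((isInsertion_replaceEdge h a).isExtremal_iff isExtremal_closedMelon).2 ih
  | melonRing h _ ih =>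
    exact ((isInsertion_replaceRing _ h).isExtremal_iff isExtremal_closedMelon).2 ih
  | expand v _ ih => exact ((isInsertion_expand v).isExtremal_iff isExtremal_closedSnail).2 ih

end PrismDiagram

theorem mainTheorem7 (D : PrismDiagram) : D.IsMaximal ↔ D.Generated :=
  PrismDiagram.isMaximal_iff_isExtremal.trans
    ⟨PrismDiagram.IsExtremal.generated, PrismDiagram.Generated.isExtremal⟩
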